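/- Let $\mathbb K$ be a field of characteristic zero and $d$ a positive integer; write $[n]=\{1,\dots,n\}$. **The algebra.** Let $Set^d$ be the category of finite sets of size divisible by $d$, with bijections as morphisms. For $A\in Set^d$ with $|A|=nd$ let $\mathrm{Sym}^{(d)}_A$ be the $\mathbb K$-vector space with basis the monomials $z_{A_1}\cdots z_{A_n}$ in commuting variables, one for each unordered partition $A=A_1\sqcup\dots\sqcup A_n$ into blocks of size $d$. A bijection $\phi:A\to B$ sends $z_{A_1}\cdots z_{A_n}$ to $z_{\phi(A_1)}\cdots z_{\phi(A_n)}$, so $\mathrm{Sym}^{(d)}$ is a functor and each $\mathrm{Sym}^{(d)}_A$ is a representation of the symmetric group $\mathfrak S_A$; multiplication of monomials gives bilinear maps $\mathrm{Sym}^{(d)}_A\times \mathrm{Sym}^{(d)}_B\to \mathrm{Sym}^{(d)}_{A\sqcup B}$. An ideal is a subfunctor $\mathscr I\subset \mathrm{Sym}^{(d)}$ with $\mathscr I_A\cdot \mathrm{Sym}^{(d)}_B\subset\mathscr I_{A\sqcup B}$ for all $A,B$. For a collection $\mathcal E$ of elements of the spaces $\mathrm{Sym}^{(d)}_A$, $\mathscr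 I(\mathcal E)$ is the smallest ideal containing $\mathcal E$. Sums of ideals are formed in each $\mathrm{Sym}^{(d)}_A$. **Tableaux and tabloids.** For a partition $\lambda$ let $D_\lambda=\{(i,j):1\le j\le\lambda_i\}$ be its Young diagram. For $\lambda\vdash nd$, a $Young^d_n$ tableau of shape $\lambda$ is a function $F:D_\lambda\to[n]$ with $|F^{-1}(i)|=d$ for all $i\in[n]$. For $A$ with $|A|=nd$ and a bijection $T:D_\lambda\to A$, let $\mathfrak c_\lambda(T)=\big(\sum_{\sigma}\sigma\big)\big(\sum_{\tau}\mathrm{sgn}(\tau)\,\tau\big)\in\mathbb K[\mathfrak S_A]$ be the Young symmetrizer, where $\sigma$ (resp. $\tau$) runs over the permutations of $A$ preserving every row (resp. column) of $T$, and let $t_F(A,T)=\mathfrak c_\lambda(T)\cdot z_{T(F^{-1}(1))}\cdots z_{T(F^{-1}(n))}\in \mathrm{Sym}^{(d)}_A$. The tabloid $[F]$ is the collection of the elements $t_F(A,T)$ for all such $A$ and $T$, and $[F]\in\mathscr I$ means that all of them belong to the ideal $\mathscr I$. **Order.** For sets of boxes $X,X'$ of size $d$, whose column indices with multiplicity are $y_1\le\dots\le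 y_d$ and $y'_1\le\dots\le y'_d$, write $X\preceq X'$ if $y_i\le y'_i$ for all $i$, and $X\prec X'$ if moreover $y_i<y'_i$ for some $i$. **Theorem.** Let $1\le k\le n$ be integers, $\lambda\vdash nd$ and $\mu\vdash kd$ partitions with $\mu\subset\lambda$, and $F:D_\lambda\to[n]$ a $Young^d_n$ tableau with $F^{-1}([k])=D_\mu$. Let $F_0=F|_{D_\mu}$, a $Young^d_k$ tableau. Let $\mathcal G$ be the collection of $Young^d_n$ tableaux $G:D_\lambda\to[n]$ such that 1. $G^{-1}(i)\preceq F^{-1}(i)$ for all $i\in[k]$, with $G^{-1}(i)\prec F^{-1}(i)$ for at least one $i\in[k]$; 2. $G^{-1}([k])=D_\delta$ for some partition $\delta\subset\lambda$. Then $$[F]\in\mathscr I([F_0])+\mathscr I([G]:G\in\mathcal G).$$ In particular, writing $G_0$ for the restriction of $G$ to $G^{-1}([k])$, $$[F]\in\mathscr I([F_0])+\mathscr I([G_0]:G\in\mathcal G).$$ -/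

import Mathlib

universe u v

namespace GenericSym

/-! ### Finite sets whose size is divisible by `d` -/

/-- Finite sets whose size is divisible by `d`: the objects of the category `Set^d`.
Its morphisms `A ⟶ B` are the bijections, written `A.carrier ≃ B.carrier` below. -/
structure DSet (d : ℕ) : Type (u + 1) where
  carrier : Type u
  finite : Finite carrier
  dvd_card : d ∣ Nat.card carrier

namespace DSet

variable {d : ℕ}

instance (A : DSet.{u} d) : Finite A.carrier := A.finite

noncomputable instance (A : DSet.{u} d) : Fintype A.carrier := Fintype.ofFinite _

noncomputable instance (A : DSet.{u} d) : DecidableEq A.carrier := Classical.decEq _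

/-- The disjoint union `A ⊔ B`. -/
abbrev sum (A B : DSet.{u} d) : DSet.{u} d where
  carrier := A.carrier ⊕ B.carrier
  finite := inferInstance
  dvd_card := by
    rw [Nat.card_sum]
    exact Nat.dvd_add A.dvd_card B.dvd_card

end DSet

/-! ### The functor `Sym^(d)` -/

/-- Unordered partitions of a set `A` into blocks of size `d`. For `d > 0` the blocks are
automatically nonempty, and for finite `A` there are `|A| / d` of them. Such a partition
`{A₁, …, Aₙ}` is the same thing as the monomial `z_{A₁} ⋯ z_{Aₙ}` in commuting variables. -/
@[ext]
structure BlockPartition (d : ℕ) (A : Type u) : Type u where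
  blocks : Set (Set A)
  ncard_eq : ∀ b ∈ blocks, b.ncard = d
  existsUnique_mem : ∀ a : A, ∃! b, b ∈ blocks ∧ a ∈ b

namespace BlockPartition

variable {d : ℕ}

/-- The image of a partition under a bijection. -/
def map {A B : Type u} (e : A ≃ B) (P : BlockPartition d A) : BlockPartition d B where
  blocks := (fun b => e '' b) '' P.blocks
  ncard_eq := by
    rintro _ ⟨b, hb, rfl⟩
    rw [Set.ncard_image_of_injective b e.injective]
    exact P.ncard_eq b hb
  existsUnique_mem := by
    intro x
    obtain ⟨b, ⟨hb, hxb⟩, huniq⟩ := P.existsUnique_mem (e.symm x)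
    refine ⟨e '' b, ⟨⟨b, hb, rfl⟩, ⟨e.symm x, hxb, by simp⟩⟩, ?_⟩
    rintro _ ⟨⟨c, hc, rfl⟩, ⟨y, hy, rfl⟩⟩
    have : c = b := huniq c ⟨hc, by simpa using hy⟩
    simp [this]

/-- The partition of `A ⊔ B` whose blocks are those of `P` and those of `Q`. -/
def sum {A B : Type u} (P : BlockPartition d A) (Q : BlockPartition d B) :
    BlockPartition d (A ⊕ B) where
  blocks := (fun b => Sum.inl '' b) '' P.blocks ∪ (fun b => Sum.inr '' b) '' Q.blocks
  ncard_eq := by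
    rintro _ (⟨b, hb, rfl⟩ | ⟨b, hb, rfl⟩)
    · rw [Set.ncard_image_of_injective b Sum.inl_injective]
      exact P.ncard_eq b hb
    · rw [Set.ncard_image_of_injective b Sum.inr_injective]
      exact Q.ncard_eq b hb
  existsUnique_mem := by
    rintro (a | a)
    · obtain ⟨b, ⟨hb, hab⟩, huniq⟩ := P.existsUnique_mem a
      refine ⟨Sum.inl '' b, ⟨Or.inl ⟨b, hb, rfl⟩, ⟨a, hab, rfl⟩⟩, ?_⟩
      rintro _ ⟨⟨c, hc, rfl⟩ | ⟨c, hc, rfl⟩, ⟨y, hy, hya⟩⟩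
      · obtain rfl := Sum.inl_injective hya
        rw [huniq c ⟨hc, hy⟩]
      · simp at hya
    · obtain ⟨b, ⟨hb, hab⟩, huniq⟩ := Q.existsUnique_mem a
      refine ⟨Sum.inr '' b, ⟨Or.inr ⟨b, hb, rfl⟩, ⟨a, hab, rfl⟩⟩, ?_⟩
      rintro _ ⟨⟨c, hc, rfl⟩ | ⟨c, hc, rfl⟩, ⟨y, hy, hya⟩⟩
      · simp at hya
      · obtain rfl := Sum.inr_injective hya
        rw [huniq c ⟨hc, hy⟩]

theorem map_refl {A : Type u} (P : BlockPartition d A) : P.map (Equiv.refl A) = P := by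
  ext b
  simp [map]

theorem map_trans {A B C : Type u} (e : A ≃ B) (f : B ≃ C) (P : BlockPartition d A) :
    P.map (e.trans f) = (P.map e).map f := by
  ext b
  simp [map, Set.image_image]

end BlockPartition

/-- The vector space `Sym^(d)_A`, with basis the monomials `z_{A₁} ⋯ z_{Aₙ}` for the partitions
`A = A₁ ⊔ ⋯ ⊔ Aₙ` into blocks of size `d`. -/
abbrev SymD (K : Type v) [Field K] (d : ℕ) (A : Type u) :=
  BlockPartition d A →₀ K

section Algebra

variable (K : Type v) [Field K] {d : ℕ}

/-- The basis element (monomial) of `Sym^(d)_A` attached to a partition. -/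
noncomputable def monomial {A : Type u} (P : BlockPartition d A) : SymD K d A :=
  Finsupp.single P 1

/-- Functoriality of `Sym^(d)`: a bijection sends `z_{A₁} ⋯ z_{Aₙ}` to `z_{e(A₁)} ⋯ z_{e(Aₙ)}`. -/
noncomputable def mapLin {A B : Type u} (e : A ≃ B) : SymD K d A →ₗ[K] SymD K d B :=
  Finsupp.lmapDomain K K (BlockPartition.map e)

theorem mapLin_refl {A : Type u} :
    mapLin K (Equiv.refl A) = (LinearMap.id : SymD K d A →ₗ[K] SymD K d A) := by
  have h : BlockPartition.map (d := d) (Equiv.refl A) = id :=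
    funext BlockPartition.map_refl
  rw [mapLin, h, Finsupp.lmapDomain_id]

theorem mapLin_trans {A B C : Type u} (e : A ≃ B) (f : B ≃ C) :
    (mapLin K (e.trans f) : SymD K d A →ₗ[K] SymD K d C) = mapLin K f ∘ₗ mapLin K e := by
  have h : BlockPartition.map (d := d) (e.trans f) =
      BlockPartition.map f ∘ BlockPartition.map e :=
    funext (BlockPartition.map_trans e f)
  rw [mapLin, h, Finsupp.lmapDomain_comp]
  rfl

/-- The multiplication `Sym^(d)_A × Sym^(d)_B → Sym^(d)_{A ⊔ B}`: the bilinear extension of the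
product of monomials. -/
noncomputable def mul {A B : Type u} :
    SymD K d A →ₗ[K] SymD K d B →ₗ[K] SymD K d (A ⊕ B) :=
  Finsupp.linearCombination K fun P : BlockPartition d A =>
    Finsupp.lmapDomain K K fun Q : BlockPartition d B => P.sum Q

theorem mul_monomial {A B : Type u} (P : BlockPartition d A) (Q : BlockPartition d B) :
    mul K (monomial K P) (monomial K Q) = monomial K (P.sum Q) := by
  simp [mul, monomial]

/-- `Sym^(d)_A` as a representation of the symmetric group of `A`. -/
noncomputable def symRep (d : ℕ) (A : Type u) :
    Representation K (Equiv.Perm A) (SymD K d A) where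
  toFun σ := mapLin K σ
  map_one' := mapLin_refl K
  map_mul' σ τ := mapLin_trans K τ σ

end Algebra

/-! ### Ideals of `Sym^(d)` -/

/-- An element of `Sym^(d)` is an element of `Sym^(d)_A` for some `A` in `Set^d`. -/
abbrev Elt (K : Type v) [Field K] (d : ℕ) :=
  Σ A : DSet.{u} d, SymD K d A.carrier

/-- An ideal of `Sym^(d)`: a subfunctor `I ⊆ Sym^(d)` with `I_A · Sym^(d)_B ⊆ I_{A ⊔ B}`.
(As the multiplication is commutative up to the swap `A ⊔ B ≃ B ⊔ A`, right ideals are the same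
as two-sided ones.) -/
structure GIdeal (K : Type v) [Field K] (d : ℕ) where
  obj : ∀ A : DSet.{u} d, Submodule K (SymD K d A.carrier)
  map_mem : ∀ {A B : DSet.{u} d} (e : A.carrier ≃ B.carrier) {x : SymD K d A.carrier},
    x ∈ obj A → mapLin K e x ∈ obj B
  mul_mem : ∀ {A B : DSet.{u} d} {x : SymD K d A.carrier} (y : SymD K d B.carrier),
    x ∈ obj A → mul K x y ∈ obj (A.sum B)

namespace GIdeal

variable {K : Type v} [Field K] {d : ℕ}

/-- The set of all elements of `Sym^(d)` which belong to the ideal. -/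
def elements (I : GIdeal.{u} K d) : Set (Elt.{u} K d) :=
  {x | x.2 ∈ I.obj x.1}

/-- The ideal generated by a set of elements of `Sym^(d)`: the intersection of all the ideals
containing it. -/
noncomputable def span (E : Set (Elt.{u} K d)) : GIdeal.{u} K d where
  obj A := ⨅ I : GIdeal.{u} K d, ⨅ _ : E ⊆ I.elements, I.obj A
  map_mem := by
    intro A B e x hx
    simp only [Submodule.mem_iInf] at hx ⊢
    exact fun I hI => I.map_mem e (hx I hI)
  mul_mem := by
    intro A B x y hx
    simp only [Submodule.mem_iInf] at hx ⊢
    exact fun I hI => GIdeal.mul_mem I y (hx I hI)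

theorem subset_span (E : Set (Elt.{u} K d)) : E ⊆ (span E).elements := by
  intro x hx
  change x.2 ∈ (span E).obj x.1
  simp only [span, Submodule.mem_iInf]
  exact fun I hI => hI hx

theorem span_le {E : Set (Elt.{u} K d)} {I : GIdeal.{u} K d} (h : E ⊆ I.elements)
    (A : DSet.{u} d) : (span E).obj A ≤ I.obj A :=
  iInf₂_le I h

/-- The sum of two ideals, `(I + J)_A = I_A + J_A`. -/
noncomputable instance : Add (GIdeal.{u} K d) where
  add I J :=
    { obj := fun A => I.obj A ⊔ J.obj A
      map_mem := by
        intro A B e x hx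
        obtain ⟨y, hy, z, hz, rfl⟩ := Submodule.mem_sup.mp hx
        rw [map_add]
        exact Submodule.add_mem_sup (I.map_mem e hy) (J.map_mem e hz)
      mul_mem := by
        intro A B x w hx
        obtain ⟨y, hy, z, hz, rfl⟩ := Submodule.mem_sup.mp hx
        rw [map_add, LinearMap.add_apply]
        exact Submodule.add_mem_sup (I.mul_mem w hy) (J.mul_mem w hz) }

theorem add_obj (I J : GIdeal.{u} K d) (A : DSet.{u} d) :
    (I + J).obj A = I.obj A ⊔ J.obj A :=
  rfl

end GIdeal

/-! ### Young symmetrizers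

A partition is identified with its Young diagram. Boxes are pairs (row, column), counted from `0`.
-/

/-- The boxes of a Young diagram. -/
abbrev Box (lam : YoungDiagram) := {c : ℕ × ℕ // c ∈ lam.cells}

/-- The column of a box. -/
def Box.col {lam : YoungDiagram} (c : Box lam) : ℕ := c.1.2

/-- The row of a box. -/
def Box.row {lam : YoungDiagram} (c : Box lam) : ℕ := c.1.1

/-- The inclusion of the boxes of `mu` into those of `lam`, for `mu ⊆ lam`. -/
def Box.incl {mu lam : YoungDiagram} (h : mu ≤ lam) (c : Box mu) : Box lam :=
  ⟨c.1, h c.2⟩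

section Symmetrizer

variable {lam : YoungDiagram} {A : Type u}

/-- The row subgroup of a Young tableau `T`, a bijection from the boxes to `A`: the permutations
of `A` that preserve each row of `T`. -/
def rowSubgroup (T : Box lam ≃ A) : Subgroup (Equiv.Perm A) where
  carrier := {σ | ∀ a, (T.symm (σ a)).row = (T.symm a).row}
  one_mem' := fun _ => rfl
  mul_mem' := fun {σ τ} hσ hτ a => (hσ (τ a)).trans (hτ a)
  inv_mem' := fun {σ} hσ a => by simpa using (hσ (σ⁻¹ a)).symm

/-- The column subgroup of a Young tableau. -/
def colSubgroup (T : Box lam ≃ A) : Subgroup (Equiv.Perm A) where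
  carrier := {σ | ∀ a, (T.symm (σ a)).col = (T.symm a).col}
  one_mem' := fun _ => rfl
  mul_mem' := fun {σ τ} hσ hτ a => (hσ (τ a)).trans (hτ a)
  inv_mem' := fun {σ} hσ a => by simpa using (hσ (σ⁻¹ a)).symm

variable (K : Type v) [Field K] [Fintype A] [DecidableEq A]

open Classical in
/-- The row symmetrizer `∑_{σ ∈ R_T} σ`. -/
noncomputable def rowSymmetrizer (T : Box lam ≃ A) : MonoidAlgebra K (Equiv.Perm A) :=
  ∑ σ : Equiv.Perm A with σ ∈ rowSubgroup T, MonoidAlgebra.single σ 1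

open Classical in
/-- The column antisymmetrizer `∑_{τ ∈ C_T} sgn(τ) τ`. -/
noncomputable def colAntisymmetrizer (T : Box lam ≃ A) : MonoidAlgebra K (Equiv.Perm A) :=
  ∑ τ : Equiv.Perm A with τ ∈ colSubgroup T,
    MonoidAlgebra.single τ (((Equiv.Perm.sign τ : ℤˣ) : ℤ) : K)

/-- The Young symmetrizer `c(T) = a(T) · b(T)`. -/
noncomputable def youngSymmetrizer (T : Box lam ≃ A) : MonoidAlgebra K (Equiv.Perm A) :=
  rowSymmetrizer K T * colAntisymmetrizer K T

end Symmetrizer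

/-! ### `Young^d_n` tableaux and tabloids -/

/-- A `Young^d_n` tableau of shape `lam`: a filling of the boxes with entries in `[n]`, each entry
being used exactly `d` times. The set `[n] = {1, …, n}` is represented by `Fin n`, counting from
`0`, so that `[k] ⊆ [n]` consists of the `i` with `i < k`. -/
structure DTableau (d n : ℕ) (lam : YoungDiagram) where
  entry : Box lam → Fin n
  card_fiber : ∀ i : Fin n, (Finset.univ.filter fun c => entry c = i).card = d

namespace DTableau

variable {d n : ℕ} {lam : YoungDiagram}

/-- The set `F⁻¹(i)` of the boxes with entry `i`. -/
def fiber (F : DTableau d n lam) (i : Fin n) : Finset (Box lam) :=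
  Finset.univ.filter fun c => F.entry c = i

/-- `F⁻¹([k])` is the Young diagram `mu`. -/
def PreimageEq (F : DTableau d n lam) (k : ℕ) (mu : YoungDiagram) : Prop :=
  ∀ c : Box lam, (F.entry c : ℕ) < k ↔ c.1 ∈ mu.cells

/-- The restriction of `F` to `F⁻¹([k])`, when this is the Young diagram `mu`; it is a `Young^d_k`
tableau of shape `mu`. -/
def restrict (F : DTableau d n lam) {k : ℕ} (hk : k ≤ n) {mu : YoungDiagram} (hmu : mu ≤ lam)
    (h : F.PreimageEq k mu) : DTableau d k mu where
  entry c := ⟨F.entry (Box.incl hmu c), (h (Box.incl hmu c)).mpr c.2⟩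
  card_fiber i := by
    refine Eq.trans ?_ (F.card_fiber (Fin.castLE hk i))
    refine Finset.card_bij (fun c _ => Box.incl hmu c) ?_ ?_ ?_
    · intro c hc
      have hc' := congrArg Fin.val (Finset.mem_filter.mp hc).2
      exact Finset.mem_filter.mpr ⟨Finset.mem_univ _, Fin.ext hc'⟩
    · intro c _ c' _ hcc
      exact Subtype.ext (congrArg (fun x : Box lam => x.1) hcc)
    · intro c hc
      have hc' : (F.entry c : ℕ) = i := congrArg Fin.val (Finset.mem_filter.mp hc).2
      have hlt : (F.entry c : ℕ) < k := hc' ▸ i.2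
      exact ⟨⟨c.1, (h c).mp hlt⟩, Finset.mem_filter.mpr ⟨Finset.mem_univ _, Fin.ext hc'⟩, rfl⟩

/-- The partition `T ∘ F⁻¹` of `A`, with blocks `T(F⁻¹(i))` for `i ∈ [n]`. -/
def blockPartition {A : Type u} (F : DTableau d n lam) (T : Box lam ≃ A) :
    BlockPartition d A where
  blocks := Set.range fun i : Fin n => T '' (F.fiber i : Set (Box lam))
  ncard_eq := by
    rintro _ ⟨i, rfl⟩
    rw [Set.ncard_image_of_injective _ T.injective, Set.ncard_coe_finset]
    exact F.card_fiber i
  existsUnique_mem := by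
    intro a
    refine ⟨T '' (F.fiber (F.entry (T.symm a)) : Set (Box lam)),
      ⟨⟨_, rfl⟩, ⟨T.symm a, by simp [fiber], by simp⟩⟩, ?_⟩
    rintro _ ⟨⟨i, rfl⟩, ⟨c, hc, rfl⟩⟩
    have : F.entry c = i := by simpa [fiber] using hc
    simp [this]

/-- The element `t_F(A, T) = c(T) · z_{T ∘ F⁻¹}` of `Sym^(d)_A`. -/
noncomputable def tabloidElt (K : Type v) [Field K] (F : DTableau d n lam) (A : DSet.{u} d)
    (T : Box lam ≃ A.carrier) : SymD K d A.carrier :=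
  (symRep K d A.carrier).asAlgebraHom (youngSymmetrizer K T) (monomial K (F.blockPartition T))

/-- The `Young^d_n` tabloid `[F]`: the collection of all the elements `t_F(A, T)`, for all `A` in
`Set^d` and all Young tableaux `T` of the shape of `F` with set of entries `A`. -/
def tabloid (K : Type v) [Field K] (F : DTableau d n lam) : Set (Elt.{u} K d) :=
  {x | ∃ (A : DSet.{u} d) (T : Box lam ≃ A.carrier), x = ⟨A, F.tabloidElt K A T⟩}

end DTableau

/-! ### The order on sets of boxes -/

/-- The columns of the boxes in `X`, with multiplicity, in weakly increasing order. -/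
def colSeq {lam : YoungDiagram} (X : Finset (Box lam)) : List ℕ :=
  (X.val.map Box.col).sort (· ≤ ·)

/-- `X ⪯ X'`: the sorted column sequences `y₁ ≤ y₂ ≤ ⋯` of `X` and `y'₁ ≤ y'₂ ≤ ⋯` of `X'` have
the same length and `yᵢ ≤ y'ᵢ` for all `i`. -/
def ColLE {lam : YoungDiagram} (X X' : Finset (Box lam)) : Prop :=
  List.Forall₂ (· ≤ ·) (colSeq X) (colSeq X')

/-- `X ≺ X'`: moreover `yᵢ < y'ᵢ` for some `i`. (Beyond the common length both values are `0`.) -/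
def ColLT {lam : YoungDiagram} (X X' : Finset (Box lam)) : Prop :=
  ColLE X X' ∧ ∃ i : ℕ, (colSeq X).getD i 0 < (colSeq X').getD i 0

/-- The collection `𝒢` attached to `F` and `k`. -/
def leftMoves {d n : ℕ} {lam : YoungDiagram} (F : DTableau d n lam) (k : ℕ) :
    Set (DTableau d n lam) :=
  {G | (∀ i : Fin n, (i : ℕ) < k → ColLE (G.fiber i) (F.fiber i)) ∧
    (∃ i : Fin n, (i : ℕ) < k ∧ ColLT (G.fiber i) (F.fiber i)) ∧
    ∃ delta : YoungDiagram, delta ≤ lam ∧ G.PreimageEq k delta}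

end GenericSym

/-! Let `c` be the Young symmetrizer of `T`, let `X = T(D_μ)`, and let `c_X` be the symmetrizer of
the restriction of `T` to `D_μ`. The theorem comes from an identity in the group algebra
(`rowSum_mul_colAlt_eq_add`): `c = x * c_X + y`, where `y` is a combination of elements `c * σ` such
that `σ` moves every letter of `X` weakly left, some letter of `X` strictly left, and takes `X` to a
diagram. Apply both sides to the monomial of `F`. The element `c_X` turns it into a product of
`t_{F₀}` with the monomial of the remaining blocks (`act_restrict_mem_span`), while `c * σ` gives
`t_G` for a tableau `G ∈ 𝒢`, obtained by moving the entries of `F` along `σ`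
(`permute_mem_leftMoves`).

The identity rests on the relations `SpechtRel`: column antisymmetry and Garnir relations under
right multiplication.

Restriction (`SpechtRel.exists_restrict`): the boxes outside `X` are removed one at a time, the
rightmost first. To remove `b` from `Z`, multiply on the right by a polynomial in the Jucys–Murphy
element, the sum of the transpositions `(s b)` with `s ∈ Z \ {b}`. On `w` it acts triangularly with
respect to the column of `b`, and its eigenvalues are the contents of the lowest boxes of the
columns. The polynomial vanishing at the contents of all columns to the right of `b` yields `w'`
which satisfies the relations of `Z \ {b}` and equals a nonzero multiple of `w` plus terms moving
other letters left.

Universality (`SpechtRel.exists_eq_mul`): an element satisfying the relations of `X` is a left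
multiple of `c_X`. This uses straightening to standard fillings (`pe_mem_relIdeal_sup_standard`) and
their linear independence (`linearIndependent_standard`).

Diagram shape: straightening once more, with the letters of `X` all equal to `0` and the others
equal to `1`, makes the image of `X` a diagram without moving its letters right.

The second assertion follows by applying the first one to each `G ∈ 𝒢`, by induction on the total of
the columns of the entries in `[k]`. -/

set_option linter.unusedSectionVars false

namespace GenericSym

/-! ### The group algebra of a finite symmetric group -/

section GroupAlgebra

variable {A : Type u} [Fintype A] [DecidableEq A]

/-- The permutations which fix every element outside of `X`. -/
def permsOf (X : Finset A) : Subgroup (Equiv.Perm A) where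
  carrier := {σ | ∀ a ∉ X, σ a = a}
  one_mem' := fun _ _ => rfl
  mul_mem' := fun {σ τ} hσ hτ a ha => by
    rw [Equiv.Perm.mul_apply, hτ a ha, hσ a ha]
  inv_mem' := fun {σ} hσ a ha => by
    rw [Equiv.Perm.inv_eq_iff_eq, hσ a ha]

theorem mem_permsOf {X : Finset A} {σ : Equiv.Perm A} :
    σ ∈ permsOf X ↔ ∀ a ∉ X, σ a = a := Iff.rfl

theorem permsOf_mono {X Y : Finset A} (h : X ⊆ Y) : permsOf X ≤ permsOf Y :=
  fun _ hσ a ha => hσ a fun h' => ha (h h')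

theorem apply_mem_of_mem_permsOf {X : Finset A} {σ : Equiv.Perm A} (hσ : σ ∈ permsOf X) {a : A}
    (ha : a ∈ X) : σ a ∈ X := by
  by_contra h
  have h1 : σ a = a := σ.injective (hσ _ h)
  exact h (h1.symm ▸ ha)

theorem apply_mem_iff_of_mem_permsOf {X : Finset A} {σ : Equiv.Perm A} (hσ : σ ∈ permsOf X)
    {a : A} : σ a ∈ X ↔ a ∈ X := by
  refine ⟨fun h => ?_, apply_mem_of_mem_permsOf hσ⟩
  simpa using apply_mem_of_mem_permsOf (inv_mem hσ) h

theorem swap_mem_permsOf {X : Finset A} {s t : A} (hs : s ∈ X) (ht : t ∈ X) :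
    Equiv.swap s t ∈ permsOf X := fun _ ha =>
  Equiv.swap_apply_of_ne_of_ne (fun h => ha (h ▸ hs)) (fun h => ha (h ▸ ht))

variable (K : Type v) [Field K]

/-- The sign of a permutation, as a scalar. -/
def sgn (σ : Equiv.Perm A) : K := ((Equiv.Perm.sign σ : ℤˣ) : ℤ)

@[simp] theorem sgn_one : sgn K (1 : Equiv.Perm A) = 1 := by simp [sgn]

@[simp] theorem sgn_mul (σ τ : Equiv.Perm A) : sgn K (σ * τ) = sgn K σ * sgn K τ := by
  simp [sgn]

@[simp] theorem sgn_inv (σ : Equiv.Perm A) : sgn K σ⁻¹ = sgn K σ := by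
  simp [sgn]

theorem sgn_swap {s t : A} (h : s ≠ t) : sgn K (Equiv.swap s t) = -1 := by
  simp [sgn, Equiv.Perm.sign_swap h]

@[simp] theorem sgn_mul_self (σ : Equiv.Perm A) : sgn K σ * sgn K σ = 1 := by
  rw [sgn, ← Int.cast_mul, ← Units.val_mul, Int.units_mul_self, Units.val_one, Int.cast_one]

/-- A permutation, as an element of the group algebra. -/
noncomputable abbrev pe (σ : Equiv.Perm A) : MonoidAlgebra K (Equiv.Perm A) :=
  MonoidAlgebra.of K (Equiv.Perm A) σ

theorem pe_eq_single (σ : Equiv.Perm A) : pe K σ = MonoidAlgebra.single σ 1 := rfl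

theorem pe_one : pe K (1 : Equiv.Perm A) = 1 := rfl

theorem pe_mul (σ τ : Equiv.Perm A) : pe K (σ * τ) = pe K σ * pe K τ := map_mul _ σ τ

open Classical in
/-- The signed sum of all permutations of `U`. -/
noncomputable def altSum (U : Finset A) : MonoidAlgebra K (Equiv.Perm A) :=
  ∑ σ : Equiv.Perm A with σ ∈ permsOf U, sgn K σ • pe K σ

/-- The sum of the transpositions which exchange `t` with an element of `U`. -/
noncomputable def jm (U : Finset A) (t : A) : MonoidAlgebra K (Equiv.Perm A) :=
  ∑ s ∈ U, pe K (Equiv.swap s t)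

variable {K}

theorem pe_mul_altSum (τ : Equiv.Perm A) (U : Finset A) :
    pe K τ * altSum K U = altSum K (U.map τ.toEmbedding) * pe K τ := by
  classical
  rw [altSum, altSum, Finset.mul_sum, Finset.sum_mul]
  refine Finset.sum_nbij' (fun σ => τ * σ * τ⁻¹) (fun σ => τ⁻¹ * σ * τ) ?_ ?_ ?_ ?_ ?_
  · intro σ hσ
    simp only [Finset.mem_filter, Finset.mem_univ, true_and, mem_permsOf, Finset.mem_map,
      Equiv.coe_toEmbedding, not_exists, not_and] at hσ ⊢
    intro a ha
    have := hσ (τ⁻¹ a) fun h => ha _ h (by simp)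
    rw [Equiv.Perm.mul_apply, Equiv.Perm.mul_apply, this]
    exact τ.apply_symm_apply a
  · intro σ hσ
    simp only [Finset.mem_filter, Finset.mem_univ, true_and, mem_permsOf, Finset.mem_map,
      Equiv.coe_toEmbedding, not_exists, not_and] at hσ ⊢
    intro a ha
    have := hσ (τ a) fun x hx h => ha (τ.injective h ▸ hx)
    simp [Equiv.Perm.mul_apply, this]
  · intro σ _; group
  · intro σ _; group
  · intro σ _
    have : sgn K (τ * σ * τ⁻¹) = sgn K σ := by
      rw [sgn_mul, sgn_mul, sgn_inv, mul_right_comm, sgn_mul_self, one_mul]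
    rw [this, mul_smul_comm, smul_mul_assoc, ← map_mul, ← map_mul]
    congr 2
    group

theorem pe_mul_jm (τ : Equiv.Perm A) (U : Finset A) (t : A) :
    pe K τ * jm K U t = jm K (U.map τ.toEmbedding) (τ t) * pe K τ := by
  rw [jm, jm, Finset.mul_sum, Finset.sum_mul, Finset.sum_map]
  refine Finset.sum_congr rfl fun s _ => ?_
  rw [← map_mul, ← map_mul, Equiv.coe_toEmbedding, Equiv.mul_swap_eq_swap_mul]

theorem map_eq_of_mem_permsOf {U : Finset A} {τ : Equiv.Perm A} (hτ : τ ∈ permsOf U) :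
    U.map τ.toEmbedding = U := by
  refine Finset.eq_of_subset_of_card_le ?_ (by simp)
  intro x hx
  obtain ⟨y, hy, rfl⟩ := Finset.mem_map.mp hx
  exact apply_mem_of_mem_permsOf hτ hy

theorem commute_pe_jm {U : Finset A} {t : A} (ht : t ∉ U) {τ : Equiv.Perm A}
    (hτ : τ ∈ permsOf U) : Commute (pe K τ) (jm K U t) := by
  have h := pe_mul_jm (K := K) τ U t
  rwa [map_eq_of_mem_permsOf hτ, hτ t ht] at h

theorem commute_altSum {y : MonoidAlgebra K (Equiv.Perm A)} {U : Finset A}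
    (h : ∀ τ ∈ permsOf U, Commute (pe K τ) y) : Commute (altSum K U) y := by
  classical
  refine Commute.sum_left _ _ _ fun τ hτ => ?_
  exact (h τ (Finset.mem_filter.mp hτ).2).smul_left _

theorem pe_swap_mul_altSum {U : Finset A} {s t : A} (hs : s ∈ U) (ht : t ∈ U) (hst : s ≠ t) :
    pe K (Equiv.swap s t) * altSum K U = -altSum K U := by
  classical
  rw [altSum, Finset.mul_sum, ← Finset.sum_neg_distrib]
  have hm := swap_mem_permsOf hs ht
  refine Finset.sum_nbij' (fun σ => Equiv.swap s t * σ) (fun σ => Equiv.swap s t * σ)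
    ?_ ?_ ?_ ?_ ?_
  · intro σ hσ
    simp only [Finset.mem_filter, Finset.mem_univ, true_and] at hσ ⊢
    exact mul_mem hm hσ
  · intro σ hσ
    simp only [Finset.mem_filter, Finset.mem_univ, true_and] at hσ ⊢
    exact mul_mem hm hσ
  · intro σ _; rw [← mul_assoc, Equiv.swap_mul_self, one_mul]
  · intro σ _; rw [← mul_assoc, Equiv.swap_mul_self, one_mul]
  · intro σ _
    rw [sgn_mul, sgn_swap K hst, mul_smul_comm, ← map_mul, neg_one_mul, neg_smul, neg_neg]

/-- Coset decomposition: a permutation of `V ∪ {t}` is uniquely `(s t) * σ` with `s` the image of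
`t` and `σ` a permutation of `V`. The transpositions with `s ≠ t` carry the sign `-1`. -/
theorem altSum_insert {V : Finset A} {t : A} (ht : t ∉ V) :
    altSum K (insert t V) = (1 - jm K V t) * altSum K V := by
  classical
  have h1 : (1 - jm K V t : MonoidAlgebra K (Equiv.Perm A)) =
      ∑ s ∈ insert t V, sgn K (Equiv.swap s t) • pe K (Equiv.swap s t) := by
    rw [Finset.sum_insert ht, Equiv.swap_self, sub_eq_add_neg, jm, ← Finset.sum_neg_distrib]
    congr 1
    · change 1 = sgn K (1 : Equiv.Perm A) • pe K (1 : Equiv.Perm A)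
      rw [sgn_one, one_smul]; rfl
    · refine Finset.sum_congr rfl fun s hs => ?_
      rw [sgn_swap K (ne_of_mem_of_not_mem hs ht), neg_one_smul]
  rw [h1, altSum, altSum, Finset.sum_mul_sum, ← Finset.sum_product']
  symm
  refine Finset.sum_bij' (fun x _ => Equiv.swap x.1 t * x.2)
    (fun σ _ => (σ t, Equiv.swap (σ t) t * σ)) ?_ ?_ ?_ ?_ ?_
  · rintro ⟨s, σ⟩ h
    simp only [Finset.mem_product, Finset.mem_filter, Finset.mem_univ, true_and] at h ⊢
    exact mul_mem (swap_mem_permsOf h.1 (Finset.mem_insert_self t V))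
      (permsOf_mono (Finset.subset_insert t V) h.2)
  · intro σ h
    simp only [Finset.mem_product, Finset.mem_filter, Finset.mem_univ, true_and] at h ⊢
    have hs : σ t ∈ insert t V := apply_mem_of_mem_permsOf h (Finset.mem_insert_self t V)
    refine ⟨hs, fun a ha => ?_⟩
    by_cases hat : a = t
    · subst hat; simp
    · exact mul_mem (swap_mem_permsOf hs (Finset.mem_insert_self t V)) h a (by simp [hat, ha])
  · rintro ⟨s, σ⟩ h
    simp only [Finset.mem_product, Finset.mem_filter, Finset.mem_univ, true_and] at h
    have : σ t = t := h.2 t ht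
    simp [Equiv.Perm.mul_apply, this]
  · intro σ _
    simp
  · rintro ⟨s, σ⟩ _
    rw [sgn_mul, smul_mul_smul_comm, ← map_mul]

theorem altSum_insert' {V : Finset A} {t : A} (ht : t ∉ V) :
    altSum K (insert t V) = altSum K V * (1 - jm K V t) := by
  rw [altSum_insert ht]
  refine ((commute_altSum fun τ hτ => ?_).eq).symm
  exact (Commute.one_right _).sub_right (commute_pe_jm ht hτ)

end GroupAlgebra

/-! ### Specht relations and the removal of one box. -/

section Specht

variable {A : Type u} [Fintype A] [DecidableEq A]

/-- Every position above and to the left of an element of `Z` is occupied by an element of `Z`. -/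
def IsDiagram (row col : A → ℕ) (Z : Finset A) : Prop :=
  ∀ x ∈ Z, ∀ i ≤ row x, ∀ j ≤ col x, ∃ y ∈ Z, row y = i ∧ col y = j

/-- The position determines the element. -/
def PosInjective (row col : A → ℕ) : Prop :=
  ∀ a b, row a = row b → col a = col b → a = b

/-- The number of elements of `Z` in column `j`. -/
def colHeight (col : A → ℕ) (Z : Finset A) (j : ℕ) : ℕ := (Z.filter (col · = j)).card

theorem IsDiagram.colHeight_antitone {row col : A → ℕ} {Z : Finset A}
    (hinj : PosInjective row col) (hZ : IsDiagram row col Z) {i j : ℕ} (hij : i ≤ j) :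
    colHeight col Z j ≤ colHeight col Z i := by
  choose! f hfZ hfr hfc using fun (x : A) (hx : x ∈ Z.filter (col · = j)) =>
    hZ x (Finset.mem_filter.mp hx).1 (row x) le_rfl i
      (by rw [(Finset.mem_filter.mp hx).2]; exact hij)
  refine Finset.card_le_card_of_injOn f (fun x hx => ?_) (fun x hx y hy hxy => ?_)
  · exact Finset.mem_coe.mpr (Finset.mem_filter.mpr ⟨hfZ x hx, hfc x hx⟩)
  · refine hinj x y ?_ ?_
    · rw [← hfr x hx, ← hfr y hy, hxy]
    · rw [(Finset.mem_filter.mp hx).2, (Finset.mem_filter.mp hy).2]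

variable {K : Type v} [Field K]

/-- The relations satisfied by the Young symmetrizer of `Z` under right multiplication: it is
antisymmetric in each column, and satisfies the Garnir relations. -/
structure SpechtRel (col : A → ℕ) (Z : Finset A) (w : MonoidAlgebra K (Equiv.Perm A)) : Prop where
  mul_pe : ∀ τ ∈ permsOf Z, (∀ a, col (τ a) = col a) → w * pe K τ = sgn K τ • w
  mul_altSum : ∀ i j, i < j → ∀ U ⊆ Z, (∀ u ∈ U, col u = i ∨ col u = j) →
    colHeight col Z i < U.card → w * altSum K U = 0

/-- The content `j - (h - 1)` of the lowest box in column `j`, where `h` is the height. -/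
def colContent (K : Type v) [Field K] (col : A → ℕ) (Z : Finset A) (j : ℕ) : K :=
  (j : K) + 1 - (colHeight col Z j : K)

/-- The span of the elements `w σ`, for the permutations `σ` such that `P σ`. -/
noncomputable def orbitSpan (w : MonoidAlgebra K (Equiv.Perm A)) (P : Equiv.Perm A → Prop) :
    Submodule K (MonoidAlgebra K (Equiv.Perm A)) :=
  Submodule.span K {x | ∃ σ, P σ ∧ x = w * pe K σ}

theorem mem_orbitSpan {w : MonoidAlgebra K (Equiv.Perm A)} {P : Equiv.Perm A → Prop}
    {σ : Equiv.Perm A} (h : P σ) : w * pe K σ ∈ orbitSpan w P :=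
  Submodule.subset_span ⟨σ, h, rfl⟩

theorem mul_mem_of_mem_orbitSpan {w : MonoidAlgebra K (Equiv.Perm A)} {P : Equiv.Perm A → Prop}
    {N : Submodule K (MonoidAlgebra K (Equiv.Perm A))} {x y : MonoidAlgebra K (Equiv.Perm A)}
    (h : ∀ σ, P σ → w * pe K σ * y ∈ N) (hx : x ∈ orbitSpan w P) : x * y ∈ N := by
  have : orbitSpan w P ≤ N.comap (LinearMap.mulRight K y) := by
    refine Submodule.span_le.mpr ?_
    rintro _ ⟨σ, hσ, rfl⟩
    exact h σ hσ
  exact this hx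

theorem commute_aeval {R : Type*} [Ring R] [Algebra K R] {x y : R} (h : Commute x y)
    (p : Polynomial K) : Commute x (Polynomial.aeval y p) := by
  induction p using Polynomial.induction_on with
  | C a => rw [Polynomial.aeval_C]; exact Algebra.commute_algebraMap_right a x
  | add p q hp hq => rw [map_add]; exact hp.add_right hq
  | monomial n a _ =>
    rw [map_mul, map_pow, Polynomial.aeval_C, Polynomial.aeval_X]
    exact (Algebra.commute_algebraMap_right a x).mul_right (h.pow_right _)

theorem orbitSpan_mono {w : MonoidAlgebra K (Equiv.Perm A)} {P Q : Equiv.Perm A → Prop}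
    (h : ∀ σ, P σ → Q σ) : orbitSpan w P ≤ orbitSpan w Q :=
  Submodule.span_mono fun _ ⟨σ, hσ, hx⟩ => ⟨σ, h σ hσ, hx⟩

namespace SpechtRel

variable {col : A → ℕ} {Z : Finset A} {w : MonoidAlgebra K (Equiv.Perm A)}

theorem mul_swap (hw : SpechtRel col Z w) {s t : A} (hs : s ∈ Z) (ht : t ∈ Z) (hst : s ≠ t)
    (hc : col s = col t) : w * pe K (Equiv.swap s t) = -w := by
  rw [hw.mul_pe _ (swap_mem_permsOf hs ht), sgn_swap K hst, neg_one_smul]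
  intro a
  rw [Equiv.swap_apply_def]
  split_ifs with h1 h2
  · rw [h1, hc]
  · rw [h2, hc]
  · rfl

open Classical in
theorem mul_altSum_col (hw : SpechtRel col Z w) {V : Finset A} (hV : V ⊆ Z) {j : ℕ}
    (hj : ∀ a ∈ V, col a = j) :
    w * altSum K V =
      ((Finset.univ.filter fun σ : Equiv.Perm A => σ ∈ permsOf V).card : K) • w := by
  rw [altSum, Finset.mul_sum, Nat.cast_smul_eq_nsmul, ← Finset.sum_const]
  refine Finset.sum_congr rfl fun σ hσ => ?_
  have hσ' := (Finset.mem_filter.mp hσ).2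
  rw [mul_smul_comm, hw.mul_pe σ (permsOf_mono hV hσ'), smul_smul, sgn_mul_self, one_smul]
  intro a
  by_cases ha : a ∈ V
  · rw [hj a ha, hj _ (apply_mem_of_mem_permsOf hσ' ha)]
  · rw [hσ' a ha]

/-- The Garnir relation for the full column `j` together with `t`: `altSum` of this set is `altSum V
* (1 - jm V t)`, and `w` absorbs `altSum V` up to the nonzero scalar `|V|!`. -/
theorem mul_jm_col [CharZero K] (hw : SpechtRel col Z w) {t : A} (ht : t ∈ Z) {j : ℕ}
    (hj : j < col t) : w * jm K (Z.filter (col · = j)) t = w := by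
  classical
  set V := Z.filter (col · = j) with hV
  have htV : t ∉ V := fun h => hj.ne (Finset.mem_filter.mp h).2.symm
  have h := hw.mul_altSum j (col t) hj (insert t V)
    (Finset.insert_subset ht (Finset.filter_subset _ _)) (fun u hu => by
      rcases Finset.mem_insert.mp hu with rfl | hu
      · exact Or.inr rfl
      · exact Or.inl (Finset.mem_filter.mp hu).2)
    (by rw [Finset.card_insert_of_notMem htV]; exact Nat.lt_succ_self _)
  rw [altSum_insert' htV, ← mul_assoc, hw.mul_altSum_col (Finset.filter_subset _ _)
    (fun a ha => (Finset.mem_filter.mp ha).2), smul_mul_assoc, smul_eq_zero] at h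
  rcases h with h | h
  · exfalso
    rw [Nat.cast_eq_zero, Finset.card_eq_zero] at h
    exact Finset.notMem_empty 1 (h ▸ Finset.mem_filter.mpr ⟨Finset.mem_univ _, one_mem _⟩)
  · rw [mul_sub, mul_one, sub_eq_zero] at h
    exact h.symm

/-- Each column to the left of `t` contributes `w` by the Garnir relation, and each other box in the
column of `t` contributes `-w` by antisymmetry. This gives the content `col t - (h - 1)`; the
columns to the right are left as they are. -/
theorem mul_jm_erase [CharZero K] (hw : SpechtRel col Z w) {t : A} (ht : t ∈ Z) :
    w * jm K (Z.erase t) t = colContent K col Z (col t) • w +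
      ∑ u ∈ Z with col t < col u, w * pe K (Equiv.swap u t) := by
  classical
  have h1 : ∑ s ∈ Z with col s < col t, w * pe K (Equiv.swap s t) = (col t : K) • w := by
    rw [← Finset.sum_fiberwise_of_maps_to (g := col) (t := Finset.range (col t))
      (fun s hs => Finset.mem_range.mpr (Finset.mem_filter.mp hs).2)]
    rw [Nat.cast_smul_eq_nsmul, ← Finset.card_range (col t), ← Finset.sum_const,
      Finset.card_range]
    refine Finset.sum_congr rfl fun j hj => ?_
    have hj' := Finset.mem_range.mp hj
    rw [Finset.filter_filter]
    have : Z.filter (fun s => col s < col t ∧ col s = j) = Z.filter (col · = j) :=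
      Finset.filter_congr fun s _ => ⟨fun h => h.2, fun h => ⟨h ▸ hj', h⟩⟩
    rw [this, ← Finset.mul_sum]
    exact hw.mul_jm_col ht hj'
  have h2 : ∑ s ∈ (Z.filter (col · = col t)).erase t, w * pe K (Equiv.swap s t) =
      (1 - (colHeight col Z (col t) : K)) • w := by
    have hmem : t ∈ Z.filter (col · = col t) := Finset.mem_filter.mpr ⟨ht, rfl⟩
    have hcard : colHeight col Z (col t) = ((Z.filter (col · = col t)).erase t).card + 1 :=
      (Finset.card_erase_add_one hmem).symm
    rw [hcard, Nat.cast_add, Nat.cast_one, sub_add_cancel_right, neg_smul,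
      Nat.cast_smul_eq_nsmul, ← Finset.sum_const, ← Finset.sum_neg_distrib]
    refine Finset.sum_congr rfl fun s hs => ?_
    obtain ⟨hst, hs⟩ := Finset.mem_erase.mp hs
    obtain ⟨hs, hc⟩ := Finset.mem_filter.mp hs
    exact hw.mul_swap hs ht hst hc
  rw [jm, Finset.mul_sum, ← Finset.sum_filter_add_sum_filter_not (Z.erase t) (col · < col t),
    ← Finset.sum_filter_add_sum_filter_not ((Z.erase t).filter fun a => ¬ col a < col t)
      (col · = col t)]
  have e1 : (Z.erase t).filter (col · < col t) = Z.filter (col · < col t) := by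
    ext a
    simp only [Finset.mem_filter, Finset.mem_erase]
    exact ⟨fun h => ⟨h.1.2, h.2⟩, fun h => ⟨⟨fun e => (e ▸ h.2).false, h.1⟩, h.2⟩⟩
  have e2 : ((Z.erase t).filter fun a => ¬ col a < col t).filter (col · = col t) =
      (Z.filter (col · = col t)).erase t := by
    ext a
    simp only [Finset.mem_filter, Finset.mem_erase]
    exact ⟨fun h => ⟨h.1.1.1, h.1.1.2, h.2⟩, fun h => ⟨⟨⟨h.1, h.2.1⟩, h.2.2.not_lt⟩, h.2.2⟩⟩
  have e3 : ((Z.erase t).filter fun a => ¬ col a < col t).filter (fun a => ¬ col a = col t) =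
      Z.filter (col t < col ·) := by
    ext a
    simp only [Finset.mem_filter, Finset.mem_erase]
    refine ⟨fun h => ⟨h.1.1.2, by omega⟩, fun h => ⟨⟨⟨fun e => ?_, h.1⟩, by omega⟩, by omega⟩⟩
    exact (e ▸ h.2).false
  rw [e1, e2, e3, h1, h2, ← add_assoc, ← add_smul, colContent]
  congr 2
  ring

/-- Triangularity of the Jucys–Murphy element: conjugation by `σ` replaces the letter `b` by the box
`σ b` it occupies, so the diagonal coefficient is the content of that column and all other terms put
`b` further right. -/
theorem mul_pe_mul_jm [CharZero K] (hw : SpechtRel col Z w) {b : A} (hb : b ∈ Z)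
    {σ : Equiv.Perm A} (hσ : σ ∈ permsOf Z) :
    w * pe K σ * jm K (Z.erase b) b = colContent K col Z (col (σ b)) • (w * pe K σ) +
      ∑ u ∈ Z with col (σ b) < col u, w * pe K (Equiv.swap u (σ b) * σ) := by
  have hmap : (Z.erase b).map σ.toEmbedding = Z.erase (σ b) := by
    rw [Finset.map_erase, map_eq_of_mem_permsOf hσ, Equiv.coe_toEmbedding]
  rw [mul_assoc, pe_mul_jm, hmap, ← mul_assoc,
    hw.mul_jm_erase (apply_mem_of_mem_permsOf hσ hb), add_mul, smul_mul_assoc, Finset.sum_mul]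
  congr 1
  refine Finset.sum_congr rfl fun u _ => ?_
  rw [mul_assoc, ← map_mul]

/-- Moving the letter `b` at least to column `j`, and then applying the product of the operators
`jm - c_i` for all the columns `i ≥ j`, gives zero. -/
theorem orbitSpan_mul_aeval_eq_zero [CharZero K] (hw : SpechtRel col Z w) {b : A} (hb : b ∈ Z)
    {M : ℕ} (hM : ∀ a ∈ Z, col a < M) {j : ℕ} (hj : j ≤ M) :
    ∀ x ∈ orbitSpan w (fun σ => σ ∈ permsOf Z ∧ j ≤ col (σ b)),
      x * Polynomial.aeval (jm K (Z.erase b) b) (∏ i ∈ Finset.Ico j M,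
        (Polynomial.X - Polynomial.C (colContent K col Z i))) = 0 := by
  induction hj using Nat.decreasingInduction with
  | self =>
    intro x hx
    refine (Submodule.mem_bot K).mp (mul_mem_of_mem_orbitSpan ?_ hx)
    intro σ hσ
    exact absurd (hM _ (apply_mem_of_mem_permsOf hσ.1 hb)) (not_lt.mpr hσ.2)
  | of_succ j hj ih =>
    intro x hx
    rw [Finset.prod_eq_prod_Ico_succ_bot hj, map_mul, ← mul_assoc]
    -- The factor of column `j` cancels the diagonal term when `b` lies in column `j`, so it pushes
    -- the span for `j` into the span for `j + 1`.
    refine ih _ (mul_mem_of_mem_orbitSpan ?_ hx)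
    intro σ hσ
    rw [map_sub, Polynomial.aeval_X, Polynomial.aeval_C, mul_sub, hw.mul_pe_mul_jm hb hσ.1,
      ← Algebra.commutes, ← Algebra.smul_def, add_sub_right_comm, ← sub_smul]
    refine add_mem ?_ (sum_mem fun u hu => mem_orbitSpan ?_)
    · rcases hσ.2.eq_or_lt with h | h
      · rw [h, sub_self, zero_smul]
        exact zero_mem _
      · exact Submodule.smul_mem _ _ (mem_orbitSpan ⟨hσ.1, h⟩)
    · obtain ⟨hu, hlt⟩ := Finset.mem_filter.mp hu
      refine ⟨mul_mem (swap_mem_permsOf hu (apply_mem_of_mem_permsOf hσ.1 hb)) hσ.1, ?_⟩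
      rw [Equiv.Perm.mul_apply, Equiv.swap_apply_right]
      have := hσ.2
      omega

/-- The permutations which move `b` to the right, every other letter being fixed or moved to
the left. -/
def LeftCycle (col : A → ℕ) (Z : Finset A) (b : A) (σ : Equiv.Perm A) : Prop :=
  σ ∈ permsOf Z ∧ (∀ s ∈ Z.erase b, σ s = s ∨ col (σ s) < col s) ∧ col b < col (σ b)

/-- The letter in box `u` trades places with `b`. It goes to the box `σ b`, which lies to the left
of `u`; as it had itself reached `u` by staying put or moving left, it is still left of its starting
box. -/
theorem swap_mul_leftCycle {b u : A} (hb : b ∈ Z) {σ : Equiv.Perm A}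
    (hσ : σ ∈ permsOf Z) (hσ' : ∀ s ∈ Z.erase b, σ s = s ∨ col (σ s) < col s)
    (hle : col b ≤ col (σ b)) (hu : u ∈ Z) (hlt : col (σ b) < col u) :
    LeftCycle col Z b (Equiv.swap u (σ b) * σ) := by
  refine ⟨mul_mem (swap_mem_permsOf hu (apply_mem_of_mem_permsOf hσ hb)) hσ, fun s hs => ?_, ?_⟩
  · rw [Equiv.Perm.mul_apply]
    have hsb := (Finset.mem_erase.mp hs).1
    by_cases h : σ s = u
    · right
      rw [h, Equiv.swap_apply_left]
      rcases hσ' s hs with h1 | h1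
      · rw [← h1, h]; exact hlt
      · rw [h] at h1; exact hlt.trans h1
    · rw [Equiv.swap_apply_of_ne_of_ne h (fun e => hsb (σ.injective e))]
      exact hσ' s hs
  · rw [Equiv.Perm.mul_apply, Equiv.swap_apply_right]
    exact hle.trans_lt hlt

/-- The span of the `LeftCycle` translates is stable under the Jucys–Murphy element, and modulo this
span `w` is an eigenvector. Hence a polynomial acts on `w` by its value at the eigenvalue. -/
theorem mul_aeval_sub_mem [CharZero K] (hw : SpechtRel col Z w) {b : A} (hb : b ∈ Z)
    (p : Polynomial K) :
    w * Polynomial.aeval (jm K (Z.erase b) b) p - p.eval (colContent K col Z (col b)) • w ∈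
      orbitSpan w (LeftCycle col Z b) := by
  have h1 : w * jm K (Z.erase b) b - colContent K col Z (col b) • w ∈
      orbitSpan w (LeftCycle col Z b) := by
    have h := hw.mul_pe_mul_jm hb (one_mem _)
    rw [pe_one, mul_one, Equiv.Perm.one_apply] at h
    rw [h, add_sub_cancel_left]
    refine sum_mem fun u hu => mem_orbitSpan ?_
    obtain ⟨hu, hlt⟩ := Finset.mem_filter.mp hu
    exact swap_mul_leftCycle hb (one_mem _) (fun s _ => Or.inl rfl) le_rfl hu hlt
  have h2 : ∀ x ∈ orbitSpan w (LeftCycle col Z b), x * jm K (Z.erase b) b ∈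
      orbitSpan w (LeftCycle col Z b) := by
    intro x hx
    refine mul_mem_of_mem_orbitSpan (fun σ hσ => ?_) hx
    rw [hw.mul_pe_mul_jm hb hσ.1]
    refine add_mem (Submodule.smul_mem _ _ (mem_orbitSpan hσ)) (sum_mem fun u hu =>
      mem_orbitSpan ?_)
    obtain ⟨hu, hlt⟩ := Finset.mem_filter.mp hu
    exact swap_mul_leftCycle hb hσ.1 hσ.2.1 hσ.2.2.le hu hlt
  induction p using Polynomial.induction_on with
  | C a =>
    rw [Polynomial.aeval_C, Polynomial.eval_C, ← Algebra.commutes, ← Algebra.smul_def, sub_self]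
    exact zero_mem _
  | add p q hp hq =>
    rw [map_add, mul_add, Polynomial.eval_add, add_smul, add_sub_add_comm]
    exact add_mem hp hq
  | monomial n a ih =>
    rw [pow_succ, ← mul_assoc, map_mul, Polynomial.aeval_X, ← mul_assoc, Polynomial.eval_mul,
      Polynomial.eval_X]
    have h3 := add_mem (h2 _ ih) (Submodule.smul_mem _
      (Polynomial.eval (colContent K col Z (col b)) (Polynomial.C a * Polynomial.X ^ n)) h1)
    rw [sub_mul, smul_mul_assoc, smul_sub, smul_smul, sub_add_sub_cancel] at h3
    exact h3

/-- The elements `w q`, with `q` a polynomial in `jm`, satisfy the relations for the diagram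
without the box `b`, when `q` kills everything which moves `b` to the right. -/
theorem erase [CharZero K] (hw : SpechtRel col Z w) {b : A} (hb : b ∈ Z) {p : Polynomial K}
    (hp : ∀ x ∈ orbitSpan w (fun σ => σ ∈ permsOf Z ∧ col b + 1 ≤ col (σ b)),
      x * Polynomial.aeval (jm K (Z.erase b) b) p = 0) :
    SpechtRel col (Z.erase b) (w * Polynomial.aeval (jm K (Z.erase b) b) p) := by
  classical
  have hcomm : ∀ τ ∈ permsOf (Z.erase b),
      Commute (pe K τ) (Polynomial.aeval (jm K (Z.erase b) b) p) := fun τ hτ => by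
    have h0 := commute_pe_jm (K := K) (Finset.notMem_erase b Z) hτ
    exact commute_aeval h0 p
  refine ⟨fun τ hτ hc => ?_, fun i j hij U hU hc hcard => ?_⟩
  · rw [mul_assoc, ← (hcomm τ hτ).eq, ← mul_assoc,
      hw.mul_pe τ (permsOf_mono (Finset.erase_subset _ _) hτ) hc, smul_mul_assoc]
  · have hcU := commute_altSum (U := U) fun τ hτ => hcomm τ (permsOf_mono hU hτ)
    rw [mul_assoc, ← hcU.eq, ← mul_assoc]
    have hUZ : U ⊆ Z := hU.trans (Finset.erase_subset _ _)
    -- Only the column of `b` loses height, so this is the only case with new Garnir relations.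
    -- There the relation of `Z` for `U ∪ {b}` reads `w * (1 - jm U b) * altSum U = 0`. In `w * jm U
    -- b`, the `m` boxes of `U` in column `i` each give `-w`, and the others move `b` right, hence
    -- are killed by `p`. What remains is `(1 + m)` times the wanted relation.
    by_cases hi : i = col b
    · have hbU : b ∉ U := fun h => Finset.notMem_erase b Z (hU h)
      have hh : colHeight col Z i = colHeight col (Z.erase b) i + 1 := by
        rw [colHeight, colHeight, Finset.filter_erase]
        exact (Finset.card_erase_add_one (Finset.mem_filter.mpr ⟨hb, hi.symm⟩)).symm
      have h := hw.mul_altSum i j hij (insert b U) (Finset.insert_subset hb hUZ) (fun u hu => by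
        rcases Finset.mem_insert.mp hu with rfl | hu
        · exact Or.inl hi.symm
        · exact hc u hu) (by rw [Finset.card_insert_of_notMem hbU, hh]; omega)
      rw [altSum_insert hbU, ← mul_assoc, mul_sub, mul_one] at h
      have hjm : w * jm K U b = -((U.filter (col · = i)).card : K) • w +
          ∑ s ∈ U with ¬ col s = i, w * pe K (Equiv.swap s b) := by
        rw [jm, Finset.mul_sum, ← Finset.sum_filter_add_sum_filter_not U (col · = i)]
        congr 1
        rw [neg_smul, Nat.cast_smul_eq_nsmul, ← Finset.sum_const, ← Finset.sum_neg_distrib]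
        refine Finset.sum_congr rfl fun s hs => ?_
        obtain ⟨hs, hsi⟩ := Finset.mem_filter.mp hs
        exact hw.mul_swap (hUZ hs) hb (ne_of_mem_of_not_mem hs hbU) (hsi.trans hi)
      have hzero : (∑ s ∈ U with ¬ col s = i, w * pe K (Equiv.swap s b)) *
          Polynomial.aeval (jm K (Z.erase b) b) p = 0 := by
        refine hp _ (sum_mem fun s hs => mem_orbitSpan ?_)
        obtain ⟨hs, hsi⟩ := Finset.mem_filter.mp hs
        refine ⟨swap_mem_permsOf (hUZ hs) hb, ?_⟩
        rw [Equiv.swap_apply_right]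
        have := hc s hs
        omega
      have h2 := congrArg (· * Polynomial.aeval (jm K (Z.erase b) b) p) h
      simp only [zero_mul] at h2
      rw [mul_assoc, hcU.eq, ← mul_assoc, hjm, sub_mul, add_mul, hzero, add_zero, smul_mul_assoc,
        neg_smul, sub_neg_eq_add, add_mul, smul_mul_assoc] at h2
      have h3 : (1 + ((U.filter (col · = i)).card : K)) •
          (w * Polynomial.aeval (jm K (Z.erase b) b) p * altSum K U) = 0 := by
        rw [add_smul, one_smul]; exact h2
      have hne : (1 + ((U.filter (col · = i)).card : K)) ≠ 0 := by
        rw [add_comm]; exact Nat.cast_add_one_ne_zero _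
      rw [mul_assoc, hcU.eq, ← mul_assoc]
      exact (smul_eq_zero.mp h3).resolve_left hne
    · have hh : colHeight col (Z.erase b) i = colHeight col Z i := by
        rw [colHeight, colHeight, Finset.filter_erase, Finset.erase_eq_of_notMem]
        exact fun h => hi (Finset.mem_filter.mp h).2.symm
      rw [hw.mul_altSum i j hij U hUZ hc (hh ▸ hcard), zero_mul]

/-- The polynomial has as roots the contents of the columns strictly to the right of `b`. Its value
at the content of the column of `b` is nonzero since these contents strictly increase with the
column. -/
theorem exists_erase [CharZero K] {row : A → ℕ} (hinj : PosInjective row col)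
    (hZ : IsDiagram row col Z) (hw : SpechtRel col Z w) {b : A} (hb : b ∈ Z) :
    ∃ (η : K) (w' : MonoidAlgebra K (Equiv.Perm A)), η ≠ 0 ∧ SpechtRel col (Z.erase b) w' ∧
      w' - η • w ∈ orbitSpan w (LeftCycle col Z b) := by
  obtain ⟨M, hM⟩ : ∃ M, ∀ a ∈ Z, col a < M :=
    ⟨Z.sup col + 1, fun a ha => Nat.lt_succ_of_le (Finset.le_sup ha)⟩
  set p : Polynomial K := ∏ i ∈ Finset.Ico (col b + 1) M,
    (Polynomial.X - Polynomial.C (colContent K col Z i)) with hp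
  refine ⟨p.eval (colContent K col Z (col b)), _, ?_,
    hw.erase hb (hw.orbitSpan_mul_aeval_eq_zero hb hM (hM b hb)), hw.mul_aeval_sub_mem hb p⟩
  rw [hp, Polynomial.eval_prod, Finset.prod_ne_zero_iff]
  intro i hi
  have hi' := (Finset.mem_Ico.mp hi).1
  have hle := hZ.colHeight_antitone hinj (i := col b) (j := i) (by omega)
  rw [Polynomial.eval_sub, Polynomial.eval_X, Polynomial.eval_C, colContent, colContent]
  intro h0
  -- Equality of contents, written without subtraction so that it descends to `ℕ`, where `col b < i`
  -- and the decrease of the heights contradict it.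
  have h1 : ((col b + colHeight col Z i : ℕ) : K) = ((i + colHeight col Z (col b) : ℕ) : K) := by
    push_cast
    linear_combination h0
  have h2 := Nat.cast_injective h1
  omega

end SpechtRel

end Specht

/-! ### Restriction to a subdiagram. -/

section Specht

variable {A : Type u} [Fintype A] [DecidableEq A] {K : Type v} [Field K]

/-- The permutations of `Z` which move each element of `X` weakly to the left, and at least one
of them strictly. -/
def MovesLeft (col : A → ℕ) (X Z : Finset A) (σ : Equiv.Perm A) : Prop :=
  σ ∈ permsOf Z ∧ (∀ s ∈ X, col (σ s) ≤ col s) ∧ ∃ s ∈ X, col (σ s) < col s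

/-- Take the lowest box in the last column of `Z \ X`. A box below it or to its right is not in `Z \
X` by maximality, nor in `X`, as otherwise the diagram `X` would contain `b`. -/
theorem exists_rightmost {row col : A → ℕ} (hinj : PosInjective row col) {X Z : Finset A}
    (hX : IsDiagram row col X) (hZ : IsDiagram row col Z) (hne : (Z \ X).Nonempty) :
    ∃ b ∈ Z \ X, IsDiagram row col (Z.erase b) ∧ ∀ a ∈ Z \ X, col a ≤ col b := by
  obtain ⟨b, hb, hmax⟩ := (Z \ X).exists_max_image (fun a => toLex (col a, row a)) hne
  have hmax' : ∀ a ∈ Z \ X, col a < col b ∨ col a = col b ∧ row a ≤ row b := fun a ha =>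
    Prod.Lex.toLex_le_toLex.mp (hmax a ha)
  obtain ⟨hbZ, hbX⟩ := Finset.mem_sdiff.mp hb
  refine ⟨b, hb, fun x hx i hi j hj => ?_, fun a ha => ?_⟩
  · obtain ⟨hxb, hxZ⟩ := Finset.mem_erase.mp hx
    obtain ⟨y, hy, rfl, rfl⟩ := hZ x hxZ i hi j hj
    refine ⟨y, Finset.mem_erase.mpr ⟨?_, hy⟩, rfl, rfl⟩
    rintro rfl
    by_cases hxX : x ∈ X
    · obtain ⟨z, hz, h1, h2⟩ := hX x hxX _ hi _ hj
      exact hbX (hinj z y h1 h2 ▸ hz)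
    · have := hmax' x (Finset.mem_sdiff.mpr ⟨hxZ, hxX⟩)
      exact hxb (hinj x y (by omega) (by omega))
  · have := hmax' a ha
    omega

theorem SpechtRel.exists_restrict [CharZero K] {row col : A → ℕ} (hinj : PosInjective row col)
    {X : Finset A} (hX : IsDiagram row col X) {Z : Finset A} (hXZ : X ⊆ Z)
    (hZ : IsDiagram row col Z) {w : MonoidAlgebra K (Equiv.Perm A)} (hw : SpechtRel col Z w) :
    ∃ (η : K) (w' : MonoidAlgebra K (Equiv.Perm A)), η ≠ 0 ∧ SpechtRel col X w' ∧
      w' - η • w ∈ orbitSpan w (MovesLeft col X Z) := by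
  induction hn : (Z \ X).card generalizing Z w with
  | zero =>
    have : Z = X := Finset.Subset.antisymm (Finset.sdiff_eq_empty_iff_subset.mp
      (Finset.card_eq_zero.mp hn)) hXZ
    subst this
    refine ⟨1, w, one_ne_zero, hw, ?_⟩
    rw [one_smul, sub_self]
    exact zero_mem _
  | succ n ih =>
    obtain ⟨b, hb, hZb, hmax⟩ := exists_rightmost hinj hX hZ
      (Finset.card_pos.mp (hn ▸ Nat.succ_pos n))
    obtain ⟨hbZ, hbX⟩ := Finset.mem_sdiff.mp hb
    obtain ⟨η₁, w₁, hη₁, hw₁, hmem₁⟩ := hw.exists_erase hinj hZ hbZ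
    have hXe : X ⊆ Z.erase b := fun a ha =>
      Finset.mem_erase.mpr ⟨ne_of_mem_of_not_mem ha hbX, hXZ ha⟩
    obtain ⟨η₂, w₂, hη₂, hw₂, hmem₂⟩ := ih hXe hZb hw₁ (by
      rw [Finset.erase_sdiff_comm, Finset.card_erase_of_mem hb, hn, Nat.add_sub_cancel])
    refine ⟨η₂ * η₁, w₂, mul_ne_zero hη₂ hη₁, hw₂, ?_⟩
    have e : w₂ - (η₂ * η₁) • w = (w₂ - η₂ • w₁) + η₂ • (w₁ - η₁ • w) := by
      rw [smul_sub, smul_smul, sub_add_sub_cancel]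
    -- As `b` lies in the last column of `Z \ X` and moves strictly right, its new box `σ b` belongs
    -- to `X`. The letter of that box is displaced, so it is a letter of `X` which moves strictly
    -- left.
    have hle : orbitSpan w (SpechtRel.LeftCycle col Z b) ≤ orbitSpan w (MovesLeft col X Z) := by
      refine orbitSpan_mono fun σ hσ => ⟨hσ.1, fun s hs => ?_, σ b, ?_, ?_⟩
      · rcases hσ.2.1 s (hXe hs) with h | h
        · rw [h]
        · exact h.le
      · by_contra h
        have := hmax _ (Finset.mem_sdiff.mpr ⟨apply_mem_of_mem_permsOf hσ.1 hbZ, h⟩)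
        exact absurd hσ.2.2 (not_lt.mpr this)
      · have hne : σ b ≠ b := fun h => (h ▸ hσ.2.2).false
        exact (hσ.2.1 _ (Finset.mem_erase.mpr ⟨hne, apply_mem_of_mem_permsOf hσ.1 hbZ⟩)).resolve_left
          fun h => hne (σ.injective h)
    rw [e]
    refine add_mem ?_ (Submodule.smul_mem _ _ (hle hmem₁))
    -- Substitute `w₁ = η₁ w + (terms w σ)`. In a product `σ * τ`, the permutation `τ` keeps the
    -- letters of `X` in boxes other than `b`, and from those `σ` moves only weakly left.
    have hle₂ : orbitSpan w₁ (MovesLeft col X (Z.erase b)) ≤ orbitSpan w (MovesLeft col X Z) := by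
      refine Submodule.span_le.mpr ?_
      rintro _ ⟨τ, hτ, rfl⟩
      have e₂ : w₁ * pe K τ = (w₁ - η₁ • w) * pe K τ + η₁ • (w * pe K τ) := by
        rw [sub_mul, smul_mul_assoc, sub_add_cancel]
      rw [e₂]
      have hτZ := permsOf_mono (Finset.erase_subset b Z) hτ.1
      refine add_mem (mul_mem_of_mem_orbitSpan (fun σ hσ => ?_) hmem₁)
        (Submodule.smul_mem _ _ (mem_orbitSpan ⟨hτZ, hτ.2⟩))
      rw [mul_assoc, ← map_mul]
      have hσ' : ∀ s ∈ X, col (σ (τ s)) ≤ col (τ s) := fun s hs => by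
        rcases hσ.2.1 _ (apply_mem_of_mem_permsOf hτ.1 (hXe hs)) with h | h
        · rw [h]
        · exact h.le
      refine mem_orbitSpan ⟨mul_mem hσ.1 hτZ, fun s hs => (hσ' s hs).trans (hτ.2.1 s hs), ?_⟩
      obtain ⟨s, hs, hlt⟩ := hτ.2.2
      exact ⟨s, hs, (hσ' s hs).trans_lt hlt⟩
    exact hle₂ hmem₂

/-! ### Straightening -/

/-- The elements of the group algebra which are killed by all `w` subject to the relations. -/
def relIdeal (K : Type v) [Field K] (col : A → ℕ) (Z : Finset A) :
    Submodule K (MonoidAlgebra K (Equiv.Perm A)) where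
  carrier := {y | ∀ w, SpechtRel col Z w → w * y = 0}
  add_mem' := fun {x y} hx hy w hw => by rw [mul_add, hx w hw, hy w hw, add_zero]
  zero_mem' := fun w _ => mul_zero w
  smul_mem' := fun c x hx w hw => by rw [mul_smul_comm, hx w hw, smul_zero]

/-- The filling of the diagram `Z` which has the letter `a` in the box `σ a` is weakly increasing
in rows and columns, for the order of the letters given by `ord`. -/
def IsStandard (row col ord : A → ℕ) (Z : Finset A) (σ : Equiv.Perm A) : Prop :=
  ∀ a a', σ a ∈ Z → σ a' ∈ Z →
    (col (σ a) = col (σ a') ∧ row (σ a) < row (σ a')) ∨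
      (row (σ a) = row (σ a') ∧ col (σ a) < col (σ a')) → ord a ≤ ord a'

/-- The sum of the values of `h` on the boxes, weighted by the letters. -/
def weight (h ord : A → ℕ) (σ : Equiv.Perm A) : ℕ := ∑ a, ord a * h (σ a)

/-- The sum of `h (σ x)` over all `x` does not depend on `σ`, so `ord` may be replaced by `ord - m`;
the weighted sums then compare term by term. -/
theorem weight_lt {h ord : A → ℕ} {σ σ' : Equiv.Perm A} (m : ℕ)
    (hle : ∀ x, (m ≤ ord x ∧ h (σ x) ≤ h (σ' x)) ∨ (ord x < m ∧ h (σ' x) ≤ h (σ x)))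
    (hlt : ∃ x, ord x < m ∧ h (σ' x) < h (σ x)) : weight h ord σ < weight h ord σ' := by
  have e : ∑ x, (h (σ x) : ℤ) = ∑ x, (h (σ' x) : ℤ) := by
    rw [Equiv.sum_comp σ fun x => (h x : ℤ), Equiv.sum_comp σ' fun x => (h x : ℤ)]
  have key : ∑ x, ((ord x : ℤ) - m) * h (σ x) < ∑ x, ((ord x : ℤ) - m) * h (σ' x) := by
    refine Finset.sum_lt_sum (fun x _ => ?_) ?_
    · rcases hle x with ⟨h1, h2⟩ | ⟨h1, h2⟩
      · exact mul_le_mul_of_nonneg_left (by exact_mod_cast h2) (by omega)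
      · exact mul_le_mul_of_nonpos_left (by exact_mod_cast h2) (by omega)
    · obtain ⟨x, h1, h2⟩ := hlt
      exact ⟨x, Finset.mem_univ x, mul_lt_mul_of_neg_left (by exact_mod_cast h2) (by omega)⟩
  simp only [sub_mul, Finset.sum_sub_distrib, ← Finset.mul_sum, e] at key
  have := (sub_lt_sub_iff_right _).mp key
  rw [weight, weight]
  exact_mod_cast this

/-- The relation between a filling and those which replace it in a straightening step. -/
def StraightensTo (row col ord : A → ℕ) (Z : Finset A) (σ σ' : Equiv.Perm A) : Prop :=
  σ' ∈ permsOf Z ∧ (∀ a, ord a = 0 → col (σ' a) ≤ col (σ a)) ∧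
    toLex (weight col ord σ, weight row ord σ) < toLex (weight col ord σ', weight row ord σ')

/-- Antisymmetry lets two letters in the wrong order in a column be exchanged, up to sign. The
column weight is unchanged and the larger letter goes down, which raises the row weight. -/
theorem straighten_column {row col ord : A → ℕ} {Z : Finset A} {σ : Equiv.Perm A}
    (hσ : σ ∈ permsOf Z) {a a' : A} (ha : σ a ∈ Z) (ha' : σ a' ∈ Z)
    (hc : col (σ a) = col (σ a')) (hr : row (σ a) < row (σ a')) (ho : ord a' < ord a) :
    pe K σ ∈ relIdeal K col Z ⊔
      Submodule.span K (pe K '' {σ' | StraightensTo row col ord Z σ σ'}) := by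
  have hne : σ a ≠ σ a' := fun h => (h ▸ hr).false
  set τ := Equiv.swap (σ a) (σ a') with hτ
  have hcτ : ∀ x, col (τ x) = col x := fun x => by
    rw [hτ, Equiv.swap_apply_def]
    split_ifs with h1 h2
    · rw [h1, hc]
    · rw [h2, hc]
    · rfl
  have e : pe K σ = (pe K σ + pe K (τ * σ)) - pe K (τ * σ) := (add_sub_cancel_right _ _).symm
  rw [e]
  refine sub_mem (Submodule.mem_sup_left fun w hw => ?_)
    (Submodule.mem_sup_right (Submodule.subset_span ⟨_, ⟨?_, ?_, ?_⟩, rfl⟩))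
  · rw [mul_add, pe_mul, ← mul_assoc, hτ, hw.mul_swap ha ha' hne hc, neg_mul, add_neg_cancel]
  · exact mul_mem (swap_mem_permsOf ha ha') hσ
  · intro x _
    rw [Equiv.Perm.mul_apply, hcτ]
  · refine Prod.Lex.toLex_lt_toLex.mpr (Or.inr ⟨?_, weight_lt (ord a) (fun x => ?_) ⟨a', ho, ?_⟩⟩)
    · simp only [weight, Equiv.Perm.mul_apply, hcτ]
    · rw [Equiv.Perm.mul_apply]
      by_cases h1 : x = a
      · subst h1
        rw [hτ, Equiv.swap_apply_left]
        exact Or.inl ⟨le_rfl, hr.le⟩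
      · by_cases h2 : x = a'
        · subst h2
          rw [hτ, Equiv.swap_apply_right]
          exact Or.inr ⟨ho, hr.le⟩
        · rw [hτ, Equiv.swap_apply_of_ne_of_ne (fun h => h1 (σ.injective h))
            (fun h => h2 (σ.injective h))]
          rcases le_or_gt (ord a) (ord x) with h | h
          · exact Or.inl ⟨h, le_rfl⟩
          · exact Or.inr ⟨h, le_rfl⟩
    · rw [Equiv.Perm.mul_apply, hτ, Equiv.swap_apply_right]
      exact hr

/-- The boxes of column `col p` from row `row p` downwards, and those of column `col q` from row
`row p` upwards. -/
def garnirSet (row col : A → ℕ) (Z : Finset A) (p q : A) : Finset A :=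
  Z.filter fun v => (col v = col p ∧ row p ≤ row v) ∨ (col v = col q ∧ row v ≤ row p)

/-- The column of `p` injects into the Garnir set without `q`: its boxes above row `row p` slide
along their rows into the column of `q`, where they land strictly above `q`. -/
theorem colHeight_lt_card_garnirSet {row col : A → ℕ} (hinj : PosInjective row col)
    {Z : Finset A} (hZ : IsDiagram row col Z) {p q : A} (hq : q ∈ Z)
    (hr : row p = row q) (hc : col p < col q) :
    colHeight col Z (col p) < (garnirSet row col Z p q).card := by
  have : Nonempty A := ⟨q⟩
  choose! f hfZ hfr hfc using fun (i : ℕ) (hi : i ≤ row q) => hZ q hq i hi (col q) le_rfl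
  have hqU : q ∈ garnirSet row col Z p q :=
    Finset.mem_filter.mpr ⟨hq, Or.inr ⟨rfl, hr.ge⟩⟩
  refine (Finset.card_le_card_of_injOn (fun v => if row p ≤ row v then v else f (row v))
    (t := (garnirSet row col Z p q).erase q) ?_ ?_).trans_lt
    (Finset.card_erase_lt_of_mem hqU)
  · intro v hv
    obtain ⟨hvZ, hvc⟩ := Finset.mem_filter.mp (Finset.mem_coe.mp hv)
    refine Finset.mem_coe.mpr (Finset.mem_erase.mpr ?_)
    dsimp only
    split_ifs with h
    · exact ⟨fun e => (e ▸ hvc ▸ hc).false, Finset.mem_filter.mpr ⟨hvZ, Or.inl ⟨hvc, h⟩⟩⟩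
    · have h1 := hfr (row v) (by omega)
      have h2 := hfc (row v) (by omega)
      refine ⟨fun e => ?_, Finset.mem_filter.mpr ⟨hfZ _ (by omega), Or.inr ⟨h2, by omega⟩⟩⟩
      rw [e] at h1
      omega
  · intro v hv v' hv' hvv
    obtain ⟨hvZ, hvc⟩ := Finset.mem_filter.mp (Finset.mem_coe.mp hv)
    obtain ⟨hvZ', hvc'⟩ := Finset.mem_filter.mp (Finset.mem_coe.mp hv')
    dsimp only at hvv
    split_ifs at hvv with h1 h2 h2
    · exact hvv
    · have := hfc (row v') (by omega)
      rw [← hvv] at this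
      omega
    · have := hfc (row v) (by omega)
      rw [hvv] at this
      omega
    · refine hinj _ _ ?_ (hvc.trans hvc'.symm)
      rw [← hfr (row v) (by omega), hvv, hfr (row v') (by omega)]

/-- With sorted columns, the letters of the Garnir set are at least `ord p` in the left column and
at most `ord q < ord p` in the right one. Every term of the Garnir relation which does not preserve
columns therefore moves large letters right and small ones left. -/
theorem straighten_row [CharZero K] {row col ord : A → ℕ} (hinj : PosInjective row col)
    {Z : Finset A} (hZ : IsDiagram row col Z) {σ : Equiv.Perm A} (hσ : σ ∈ permsOf Z)
    (hcol : ∀ a a', σ a ∈ Z → σ a' ∈ Z → col (σ a) = col (σ a') → row (σ a) < row (σ a') →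
      ord a ≤ ord a')
    {p q : A} (hp : σ p ∈ Z) (hq : σ q ∈ Z) (hr : row (σ p) = row (σ q))
    (hc : col (σ p) < col (σ q)) (ho : ord q < ord p) :
    pe K σ ∈ relIdeal K col Z ⊔
      Submodule.span K (pe K '' {σ' | StraightensTo row col ord Z σ σ'}) := by
  classical
  set U := garnirSet row col Z (σ p) (σ q) with hU
  have hUZ : U ⊆ Z := Finset.filter_subset _ _
  have hcol' : ∀ a a', σ a ∈ Z → σ a' ∈ Z → col (σ a) = col (σ a') → row (σ a) ≤ row (σ a') →
      ord a ≤ ord a' := fun a a' h1 h2 h3 h4 => by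
    rcases h4.eq_or_lt with h | h
    · rw [σ.injective (hinj _ _ h h3)]
    · exact hcol a a' h1 h2 h3 h
  have hUc : ∀ u ∈ U, (col u = col (σ p) ∧ row (σ p) ≤ row u) ∨
      (col u = col (σ q) ∧ row u ≤ row (σ p)) := fun u hu => (Finset.mem_filter.mp hu).2
  have hgarnir : altSum K U * pe K σ ∈ relIdeal K col Z := fun w hw => by
    rw [← mul_assoc, hw.mul_altSum _ _ hc U hUZ (fun u hu => (hUc u hu).imp And.left And.left)
      (colHeight_lt_card_garnirSet hinj hZ hq hr hc), zero_mul]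
  set S : Finset (Equiv.Perm A) := Finset.univ.filter (· ∈ permsOf U) with hS
  set S₁ := S.filter fun ρ => ∀ a, col (ρ a) = col a with hS₁
  set S₂ := S.filter fun ρ => ¬ ∀ a, col (ρ a) = col a with hS₂
  have hone : (1 : Equiv.Perm A) ∈ S₁ :=
    Finset.mem_filter.mpr ⟨Finset.mem_filter.mpr ⟨Finset.mem_univ _, one_mem _⟩, fun _ => rfl⟩
  have hcard : (S₁.card : K) ≠ 0 := Nat.cast_ne_zero.mpr (Finset.card_ne_zero_of_mem hone)
  have h₁ : ∑ ρ ∈ S₁, (sgn K ρ • pe K ρ * pe K σ - pe K σ) ∈ relIdeal K col Z := by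
    refine sum_mem fun ρ hρ w hw => ?_
    obtain ⟨hρ, hρc⟩ := Finset.mem_filter.mp hρ
    rw [mul_sub, ← mul_assoc, mul_smul_comm,
      hw.mul_pe ρ (permsOf_mono hUZ (Finset.mem_filter.mp hρ).2) hρc, smul_smul, sgn_mul_self,
      one_smul, sub_self]
  have h₂ : ∑ ρ ∈ S₂, sgn K ρ • pe K ρ * pe K σ ∈
      Submodule.span K (pe K '' {σ' | StraightensTo row col ord Z σ σ'}) := by
    refine sum_mem fun ρ hρ => ?_
    obtain ⟨hρ, hρc⟩ := Finset.mem_filter.mp hρ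
    replace hρ := (Finset.mem_filter.mp hρ).2
    rw [smul_mul_assoc, ← map_mul]
    refine Submodule.smul_mem _ _ (Submodule.subset_span ⟨_, ?_, rfl⟩)
    have hmv : ∀ x, (ord p ≤ ord x ∧ col (σ x) ≤ col ((ρ * σ) x)) ∨
        (ord x < ord p ∧ col ((ρ * σ) x) ≤ col (σ x)) := fun x => by
      rw [Equiv.Perm.mul_apply]
      by_cases hx : σ x ∈ U
      · have h2 := hUc _ (apply_mem_of_mem_permsOf hρ hx)
        rcases hUc _ hx with h1 | h1
        · exact Or.inl ⟨hcol' p x hp (hUZ hx) h1.1.symm h1.2, by omega⟩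
        · exact Or.inr ⟨(hcol' x q (hUZ hx) hq h1.1 (by omega)).trans_lt ho, by omega⟩
      · rw [hρ _ hx]
        rcases le_or_gt (ord p) (ord x) with h | h
        · exact Or.inl ⟨h, le_rfl⟩
        · exact Or.inr ⟨h, le_rfl⟩
    refine ⟨mul_mem (permsOf_mono hUZ hρ) hσ, fun x hx => ?_, ?_⟩
    · rcases hmv x with h | h
      · omega
      · exact h.2
    · refine Prod.Lex.toLex_lt_toLex.mpr (Or.inl (weight_lt (ord p) hmv ?_))
      -- If no letter smaller than `ord p` moved strictly left, no letter at all would move left.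
      -- Since the total of the columns is invariant, `ρ` would preserve every column.
      by_contra! hcon
      refine hρc fun a => ?_
      have hle : ∀ x ∈ Finset.univ, col (σ x) ≤ col ((ρ * σ) x) := fun x _ => by
        rcases hmv x with h | h
        · exact h.2
        · exact hcon x h.1
      have hsum : ∑ x, col (σ x) = ∑ x, col ((ρ * σ) x) := by
        rw [Equiv.sum_comp σ col, Equiv.sum_comp (ρ * σ) col]
      have := (Finset.sum_eq_sum_iff_of_le hle).mp hsum (σ⁻¹ a) (Finset.mem_univ _)
      simpa using this.symm
  -- The Garnir relation solved for `σ`: the column-preserving terms all agree with `pe K σ` modulo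
  -- the relations, so `σ` occurs with the nonzero coefficient `|S₁|`.
  have e : pe K σ = (S₁.card : K)⁻¹ • (altSum K U * pe K σ -
      ∑ ρ ∈ S₁, (sgn K ρ • pe K ρ * pe K σ - pe K σ) -
      ∑ ρ ∈ S₂, sgn K ρ • pe K ρ * pe K σ) := by
    rw [altSum, ← hS, ← Finset.sum_filter_add_sum_filter_not S fun ρ => ∀ a, col (ρ a) = col a,
      ← hS₁, ← hS₂, add_mul, Finset.sum_mul, Finset.sum_mul, Finset.sum_sub_distrib,
      Finset.sum_const, add_sub_right_comm, add_sub_cancel_right, sub_sub_cancel,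
      ← Nat.cast_smul_eq_nsmul K, smul_smul, inv_mul_cancel₀ hcard, one_smul]
  rw [e]
  exact Submodule.smul_mem _ _ (sub_mem (Submodule.mem_sup_left (sub_mem hgarnir h₁))
    (Submodule.mem_sup_right h₂))

/-- Each straightening step strictly raises the pair (column weight, row weight), and there are
finitely many permutations. Letters of order `0` never move right, whichever step is used. Repeated
values of `ord` are allowed: both an injective order and a two-valued one are used below. -/
theorem pe_mem_relIdeal_sup_standard [CharZero K] {row col : A → ℕ} (ord : A → ℕ)
    (hinj : PosInjective row col) {Z : Finset A} (hZ : IsDiagram row col Z) {σ : Equiv.Perm A}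
    (hσ : σ ∈ permsOf Z) :
    pe K σ ∈ relIdeal K col Z ⊔ Submodule.span K (pe K '' {σ' | σ' ∈ permsOf Z ∧
      IsStandard row col ord Z σ' ∧ ∀ a, ord a = 0 → col (σ' a) ≤ col (σ a)}) := by
  let key : Equiv.Perm A → ℕ ×ₗ ℕ := fun σ => toLex (weight col ord σ, weight row ord σ)
  let r : Equiv.Perm A → Equiv.Perm A → Prop := fun σ' σ => key σ < key σ'
  have : IsTrans _ r := ⟨fun _ _ _ h1 h2 => lt_trans h2 h1⟩
  have : Std.Irrefl r := ⟨fun _ h => lt_irrefl _ h⟩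
  induction σ using (Finite.wellFounded_of_trans_of_irrefl r).induction with
  | _ σ ih =>
  by_cases hstd : IsStandard row col ord Z σ
  · exact Submodule.mem_sup_right (Submodule.subset_span ⟨σ, ⟨hσ, hstd, fun _ _ => le_rfl⟩, rfl⟩)
  · have hstep : pe K σ ∈ relIdeal K col Z ⊔
        Submodule.span K (pe K '' {σ' | StraightensTo row col ord Z σ σ'}) := by
      by_cases hcol : ∀ a a', σ a ∈ Z → σ a' ∈ Z → col (σ a) = col (σ a') →
          row (σ a) < row (σ a') → ord a ≤ ord a'
      · have : ∃ a a', σ a ∈ Z ∧ σ a' ∈ Z ∧ row (σ a) = row (σ a') ∧ col (σ a) < col (σ a') ∧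
            ord a' < ord a := by
          by_contra! hcon
          refine hstd fun a a' ha ha' h => ?_
          rcases h with h | h
          · exact hcol a a' ha ha' h.1 h.2
          · exact hcon a a' ha ha' h.1 h.2
        obtain ⟨p, q, hp, hq, hr, hc, ho⟩ := this
        exact straighten_row hinj hZ hσ hcol hp hq hr hc ho
      · push Not at hcol
        obtain ⟨a, a', ha, ha', hc, hr, ho⟩ := hcol
        exact straighten_column hσ ha ha' hc hr ho
    refine SetLike.le_def.mp (sup_le le_sup_left (Submodule.span_le.mpr ?_)) hstep
    rintro _ ⟨σ', ⟨h1, h2, h3⟩, rfl⟩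
    refine SetLike.le_def.mp (sup_le_sup le_rfl (Submodule.span_mono (Set.image_mono ?_)))
      (ih σ' h3 h1)
    rintro τ ⟨h4, h5, h6⟩
    exact ⟨h4, h5, fun a ha => (h6 a ha).trans (h2 a ha)⟩

/-! ### The Young symmetrizer of a diagram -/

open Classical in
/-- The sum of the permutations of `X` which preserve the rows. -/
noncomputable def rowSum (K : Type v) [Field K] (row : A → ℕ) (X : Finset A) :
    MonoidAlgebra K (Equiv.Perm A) :=
  ∑ σ : Equiv.Perm A with σ ∈ permsOf X ∧ ∀ a, row (σ a) = row a, pe K σ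

open Classical in
/-- The signed sum of the permutations of `X` which preserve the columns. -/
noncomputable def colAlt (K : Type v) [Field K] (col : A → ℕ) (X : Finset A) :
    MonoidAlgebra K (Equiv.Perm A) :=
  ∑ τ : Equiv.Perm A with τ ∈ permsOf X ∧ ∀ a, col (τ a) = col a, sgn K τ • pe K τ

theorem rowSum_mul_pe {row : A → ℕ} {X : Finset A} {ρ : Equiv.Perm A} (hρ : ρ ∈ permsOf X)
    (hr : ∀ a, row (ρ a) = row a) : rowSum K row X * pe K ρ = rowSum K row X := by
  classical
  have hr' : ∀ a, row (ρ⁻¹ a) = row a := fun a => by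
    rw [← hr (ρ⁻¹ a)]; exact congrArg row (ρ.apply_symm_apply a)
  rw [rowSum, Finset.sum_mul]
  refine Finset.sum_nbij' (· * ρ) (· * ρ⁻¹) ?_ ?_ ?_ ?_ ?_
  · intro σ hσ
    simp only [Finset.mem_filter, Finset.mem_univ, true_and] at hσ ⊢
    exact ⟨mul_mem hσ.1 hρ, fun a => by rw [Equiv.Perm.mul_apply, hσ.2, hr]⟩
  · intro σ hσ
    simp only [Finset.mem_filter, Finset.mem_univ, true_and] at hσ ⊢
    exact ⟨mul_mem hσ.1 (inv_mem hρ), fun a => by rw [Equiv.Perm.mul_apply, hσ.2, hr']⟩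
  · intro σ _; exact mul_inv_cancel_right σ ρ
  · intro σ _; exact inv_mul_cancel_right σ ρ
  · intro σ _; rw [← map_mul]

theorem colAlt_mul_pe {col : A → ℕ} {X : Finset A} {ρ : Equiv.Perm A} (hρ : ρ ∈ permsOf X)
    (hr : ∀ a, col (ρ a) = col a) : colAlt K col X * pe K ρ = sgn K ρ • colAlt K col X := by
  classical
  have hr' : ∀ a, col (ρ⁻¹ a) = col a := fun a => by
    rw [← hr (ρ⁻¹ a)]; exact congrArg col (ρ.apply_symm_apply a)
  rw [colAlt, Finset.sum_mul, Finset.smul_sum]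
  refine Finset.sum_nbij' (· * ρ) (· * ρ⁻¹) ?_ ?_ ?_ ?_ ?_
  · intro σ hσ
    simp only [Finset.mem_filter, Finset.mem_univ, true_and] at hσ ⊢
    exact ⟨mul_mem hσ.1 hρ, fun a => by rw [Equiv.Perm.mul_apply, hσ.2, hr]⟩
  · intro σ hσ
    simp only [Finset.mem_filter, Finset.mem_univ, true_and] at hσ ⊢
    exact ⟨mul_mem hσ.1 (inv_mem hρ), fun a => by rw [Equiv.Perm.mul_apply, hσ.2, hr']⟩
  · intro σ _; exact mul_inv_cancel_right σ ρ
  · intro σ _; exact inv_mul_cancel_right σ ρ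
  · intro σ _
    rw [smul_mul_assoc, ← map_mul, smul_smul, sgn_mul, mul_left_comm, sgn_mul_self, mul_one]

/-- Pigeonhole: sliding `U` along rows into column `i` makes two elements collide, so they share a
row. Their transposition is absorbed by `rowSum` and negates `altSum`. -/
theorem rowSum_mul_altSum_eq_zero [CharZero K] {row col : A → ℕ} {X : Finset A}
    (hX : IsDiagram row col X) {i j : ℕ} (hij : i < j) {U : Finset A}
    (hUX : U ⊆ X) (hU : ∀ u ∈ U, col u = i ∨ col u = j) (hcard : colHeight col X i < U.card) :
    rowSum K row X * altSum K U = 0 := by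
  choose! f hfX hfr hfc using fun (x : A) (hx : x ∈ U) =>
    hX x (hUX hx) (row x) le_rfl i (by have := hU x hx; omega)
  obtain ⟨s, hs, t, ht, hst, hf⟩ := Finset.exists_ne_map_eq_of_card_lt_of_maps_to
    (t := X.filter (col · = i)) hcard (f := f)
    (fun x hx => Finset.mem_filter.mpr ⟨hfX x hx, hfc x hx⟩)
  have hrow : row s = row t := by rw [← hfr s hs, hf, hfr t ht]
  have h1 : rowSum K row X * pe K (Equiv.swap s t) = rowSum K row X := by
    refine rowSum_mul_pe (swap_mem_permsOf (hUX hs) (hUX ht)) fun a => ?_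
    rw [Equiv.swap_apply_def]
    split_ifs with h1 h2
    · rw [h1, hrow]
    · rw [h2, hrow]
    · rfl
  have h2 : rowSum K row X * altSum K U = -(rowSum K row X * altSum K U) := by
    conv_lhs => rw [← h1, mul_assoc, pe_swap_mul_altSum hs ht hst, mul_neg]
  rw [eq_neg_iff_add_eq_zero, ← two_smul K] at h2
  exact (smul_eq_zero.mp h2).resolve_left two_ne_zero

/-- For the Garnir relations, each column permutation passes through `altSum K U`, replacing `U` by
a set of the same size in the same two columns; then `rowSum_mul_altSum_eq_zero` applies. -/
theorem spechtRel_rowSum_mul_colAlt [CharZero K] {row col : A → ℕ}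
    {X : Finset A} (hX : IsDiagram row col X) :
    SpechtRel col X (rowSum K row X * colAlt K col X) := by
  classical
  refine ⟨fun τ hτ hc => ?_, fun i j hij U hUX hU hcard => ?_⟩
  · rw [mul_assoc, colAlt_mul_pe hτ hc, mul_smul_comm]
  · rw [mul_assoc, colAlt, Finset.sum_mul, Finset.mul_sum]
    refine Finset.sum_eq_zero fun τ hτ => ?_
    obtain ⟨hτ, hc⟩ := (Finset.mem_filter.mp hτ).2
    rw [smul_mul_assoc, pe_mul_altSum, mul_smul_comm, ← mul_assoc,
      rowSum_mul_altSum_eq_zero hX hij ?_ ?_ (by rwa [Finset.card_map]), zero_mul, smul_zero]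
    · intro x hx
      obtain ⟨y, hy, rfl⟩ := Finset.mem_map.mp hx
      exact apply_mem_of_mem_permsOf hτ (hUX hy)
    · intro x hx
      obtain ⟨y, hy, rfl⟩ := Finset.mem_map.mp hx
      rw [Equiv.coe_toEmbedding, hc]
      exact hU y hy

end Specht

/-! ### Independence of the standard fillings and universality of the Young symmetrizer. -/

section Specht

variable {A : Type u} [Fintype A] [DecidableEq A] {K : Type v} [Field K]

theorem exists_first_ne {n : ℕ} (e : A ≃ Fin n) {σ σ' : Equiv.Perm A} (h : σ ≠ σ') :
    ∃ a, σ a ≠ σ' a ∧ ∀ a', e a' < e a → σ a' = σ' a' := by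
  have hne : (Finset.univ.filter fun a => σ a ≠ σ' a).Nonempty := by
    by_contra hcon
    rw [Finset.not_nonempty_iff_eq_empty, Finset.filter_eq_empty_iff] at hcon
    exact h (Equiv.ext fun a => not_not.mp (hcon (Finset.mem_univ a)))
  obtain ⟨a, ha, hmin⟩ := Finset.exists_min_image _ e hne
  refine ⟨a, (Finset.mem_filter.mp ha).2, fun a' h' => ?_⟩
  by_contra hcon
  exact absurd h' (not_lt.mpr (hmin a' (Finset.mem_filter.mpr ⟨Finset.mem_univ _, hcon⟩)))

/-- The sequence of the rows of the letters. -/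
def rowSeq {n : ℕ} (e : A ≃ Fin n) (row : A → ℕ) (σ : Equiv.Perm A) : Lex (Fin n → ℕ) :=
  toLex fun i => row (σ (e.symm i))

/-- The first letter displaced by `τ` takes the box of a later letter in its own column, and in a
standard filling that box is lower. -/
theorem rowSeq_lt {n : ℕ} (e : A ≃ Fin n) {row col : A → ℕ} (hinj : PosInjective row col)
    {X : Finset A} {σ τ : Equiv.Perm A} (hstd : IsStandard row col (fun a => e a) X σ)
    (hτ : τ ∈ permsOf X) (hc : ∀ a, col (τ a) = col a) (hne : τ ≠ 1) :
    rowSeq e row σ < rowSeq e row (τ * σ) := by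
  obtain ⟨a, ha, hmin⟩ := exists_first_ne e (σ := τ * σ) (σ' := σ)
    fun h => hne (mul_eq_right.mp h)
  refine ⟨e a, fun j hj => ?_, ?_⟩
  · have := hmin (e.symm j) (by simpa using hj)
    exact (congrArg row this).symm
  · change row (σ (e.symm (e a))) < row ((τ * σ) (e.symm (e a)))
    rw [Equiv.symm_apply_apply]
    rw [Equiv.Perm.mul_apply] at ha ⊢
    have hσa : σ a ∈ X := by
      by_contra h
      exact ha (hτ _ h)
    obtain ⟨b, hb⟩ := σ.surjective (τ (σ a))
    rw [← hb] at ha ⊢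
    have hba : e a < e b := by
      rcases lt_trichotomy (e b) (e a) with h | h | h
      · have := hmin b h
        rw [Equiv.Perm.mul_apply, hb] at this
        exact absurd (hb.trans (τ.injective this)) ha
      · exact absurd (congrArg σ (e.injective h)) ha
      · exact h
    have hcb : col (σ b) = col (σ a) := by rw [hb, hc]
    have hσb : σ b ∈ X := hb ▸ apply_mem_of_mem_permsOf hτ hσa
    rcases lt_trichotomy (row (σ b)) (row (σ a)) with h | h | h
    · exact absurd (hstd b a hσb hσa (Or.inl ⟨hcb, h⟩)) (not_le.mpr hba)
    · exact absurd (hinj _ _ h hcb) ha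
    · exact h

/-- At the first letter where the fillings differ, one of them places it further left in the same
row. In the other filling that box must hold an earlier letter, on which both fillings agree,
contradicting injectivity. -/
theorem eq_of_isStandard {n : ℕ} (e : A ≃ Fin n) {row col : A → ℕ} (hinj : PosInjective row col)
    {X : Finset A} {σ σ' : Equiv.Perm A} (hσ : σ ∈ permsOf X) (hσ' : σ' ∈ permsOf X)
    (hstd : IsStandard row col (fun a => e a) X σ)
    (hstd' : IsStandard row col (fun a => e a) X σ') (hr : ∀ a, row (σ a) = row (σ' a)) :
    σ = σ' := by
  have key : ∀ {σ σ' : Equiv.Perm A}, σ ∈ permsOf X → σ' ∈ permsOf X →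
      IsStandard row col (fun a => e a) X σ' → (∀ a, row (σ a) = row (σ' a)) → ∀ a,
      σ a ≠ σ' a → (∀ a', e a' < e a → σ a' = σ' a') → ¬ col (σ a) < col (σ' a) := by
    intro σ σ' hσ hσ' hstd' hr a ha hmin hlt
    have haX : a ∈ X := by
      by_contra h
      exact ha ((hσ a h).trans (hσ' a h).symm)
    obtain ⟨b, hb⟩ := σ'.surjective (σ a)
    have hle := hstd' b a (hb ▸ apply_mem_of_mem_permsOf hσ haX)
      (apply_mem_of_mem_permsOf hσ' haX) (Or.inr ⟨by rw [hb, hr], by rw [hb]; exact hlt⟩)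
    have hle' : e b ≤ e a := hle
    rcases hle'.eq_or_lt with h | h
    · rw [e.injective h] at hb
      exact ha hb.symm
    · have := hmin b h
      rw [hb] at this
      rw [σ.injective this] at h
      exact h.false
  by_contra hne
  obtain ⟨a, ha, hmin⟩ := exists_first_ne e hne
  rcases lt_trichotomy (col (σ a)) (col (σ' a)) with h | h | h
  · exact key hσ hσ' hstd' hr a ha hmin h
  · exact ha (hinj _ _ (hr a) h)
  · exact key hσ' hσ hstd (fun a => (hr a).symm) a ha.symm (fun a' h' => (hmin a' h').symm) h

/-- Unitriangularity: row permutations keep `rowSeq` and nontrivial column permutations raise it, so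
among standard fillings `σ'` with `rowSeq` at most that of `σ`, only `σ' = σ` occurs in `c * σ`, and
only once. -/
theorem eq_one_of_mul_eq {n : ℕ} (e : A ≃ Fin n) {row col : A → ℕ} (hinj : PosInjective row col)
    {X : Finset A} {σ σ' ρ τ : Equiv.Perm A} (hσ : σ ∈ permsOf X) (hσ' : σ' ∈ permsOf X)
    (hstd : IsStandard row col (fun a => e a) X σ)
    (hstd' : IsStandard row col (fun a => e a) X σ')
    (hle : rowSeq e row σ' ≤ rowSeq e row σ) (hρ : ∀ a, row (ρ a) = row a)
    (hτ : τ ∈ permsOf X) (hc : ∀ a, col (τ a) = col a) (h : ρ * τ * σ = σ') :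
    ρ = 1 ∧ τ = 1 ∧ σ = σ' := by
  have hτ1 : τ = 1 := by
    by_contra hne
    have h1 := rowSeq_lt e hinj hstd hτ hc hne
    have h2 : rowSeq e row σ' = rowSeq e row (τ * σ) := by
      rw [← h, rowSeq, rowSeq, mul_assoc]
      congr 1
      funext i
      rw [Equiv.Perm.mul_apply ρ, hρ]
    exact absurd (h2 ▸ hle) (not_le.mpr h1)
  subst hτ1
  rw [mul_one] at h
  have hσσ : σ = σ' := eq_of_isStandard e hinj hσ hσ' hstd hstd' fun a => by
    rw [← h, Equiv.Perm.mul_apply, hρ]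
  refine ⟨?_, rfl, hσσ⟩
  rw [hσσ] at h
  exact mul_eq_right.mp h

open Classical in
theorem rowSum_mul_colAlt (row col : A → ℕ) (X : Finset A) :
    rowSum K row X * colAlt K col X =
      ∑ ρ : Equiv.Perm A with ρ ∈ permsOf X ∧ ∀ a, row (ρ a) = row a,
        ∑ τ : Equiv.Perm A with τ ∈ permsOf X ∧ ∀ a, col (τ a) = col a,
          sgn K τ • pe K (ρ * τ) := by
  rw [rowSum, colAlt, Finset.sum_mul_sum]
  refine Finset.sum_congr rfl fun ρ _ => Finset.sum_congr rfl fun τ _ => ?_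
  rw [mul_smul_comm, pe_mul]

theorem coeff_rowSum_mul_colAlt_mul_pe {row col : A → ℕ} {X : Finset A} {σ σ' : Equiv.Perm A}
    (h : ∀ ρ τ : Equiv.Perm A, ρ ∈ permsOf X → (∀ a, row (ρ a) = row a) → τ ∈ permsOf X →
      (∀ a, col (τ a) = col a) → ρ * τ * σ = σ' → ρ = 1 ∧ τ = 1 ∧ σ = σ') :
    (rowSum K row X * colAlt K col X * pe K σ).coeff σ' = if σ = σ' then 1 else 0 := by
  classical
  rw [rowSum_mul_colAlt, Finset.sum_mul]
  simp only [Finset.sum_mul, smul_mul_assoc, MonoidAlgebra.single_mul_single,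
    MonoidAlgebra.coeff_sum,
    Finsupp.finsetSum_apply, MonoidAlgebra.coeff_smul, Finsupp.smul_apply, MonoidAlgebra.of_apply,
    MonoidAlgebra.coeff_single, Finsupp.single_apply, smul_eq_mul, mul_ite, mul_one, mul_zero]
  rw [Finset.sum_eq_single 1, Finset.sum_eq_single 1]
  · rw [sgn_one, one_mul, one_mul]
  · intro τ hτ hne
    obtain ⟨hτ, hc⟩ := (Finset.mem_filter.mp hτ).2
    exact if_neg fun h' => hne (h 1 τ (one_mem _) (fun _ => rfl) hτ hc h').2.1
  · intro h'
    exact absurd (Finset.mem_filter.mpr ⟨Finset.mem_univ _, one_mem _, fun _ => rfl⟩) h'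
  · intro ρ hρ hne
    obtain ⟨hρ, hr⟩ := (Finset.mem_filter.mp hρ).2
    refine Finset.sum_eq_zero fun τ hτ => ?_
    obtain ⟨hτ, hc⟩ := (Finset.mem_filter.mp hτ).2
    exact if_neg fun h' => hne (h ρ τ hρ hr hτ hc h').1
  · intro h'
    exact absurd (Finset.mem_filter.mpr ⟨Finset.mem_univ _, one_mem _, fun _ => rfl⟩) h'

/-- The multiples of the Young symmetrizer by the standard fillings are linearly independent. -/
theorem linearIndependent_standard {n : ℕ} (e : A ≃ Fin n) {row col : A → ℕ}
    (hinj : PosInjective row col) (X : Finset A) :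
    LinearIndependent K
      fun σ : {σ : Equiv.Perm A // σ ∈ permsOf X ∧ IsStandard row col (fun a => e a) X σ} =>
        rowSum K row X * colAlt K col X * pe K σ.1 := by
  classical
  rw [linearIndependent_iff']
  intro s g hg
  by_contra! hcon
  obtain ⟨i₀, hi₀, hgi₀⟩ := hcon
  -- In a linear relation, the permutation with least `rowSeq` among those with nonzero coefficient
  -- occurs in no other term.
  obtain ⟨i, hi, hmin⟩ := (s.filter fun i => g i ≠ 0).exists_min_image
    (fun i => rowSeq e row i.1) ⟨i₀, Finset.mem_filter.mpr ⟨hi₀, hgi₀⟩⟩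
  obtain ⟨his, hgi⟩ := Finset.mem_filter.mp hi
  have h := congrArg (fun y : MonoidAlgebra K (Equiv.Perm A) => y.coeff i.1) hg
  simp only [MonoidAlgebra.coeff_sum, Finsupp.finsetSum_apply, MonoidAlgebra.coeff_smul,
    Finsupp.smul_apply, MonoidAlgebra.coeff_zero, Finsupp.coe_zero, Pi.zero_apply] at h
  rw [Finset.sum_eq_single i] at h
  · rw [coeff_rowSum_mul_colAlt_mul_pe fun ρ τ _ hr hτ hc h' =>
      eq_one_of_mul_eq e hinj i.2.1 i.2.1 i.2.2 i.2.2 le_rfl hr hτ hc h', if_pos rfl,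
      smul_eq_mul, mul_one] at h
    exact hgi h
  · intro j hj hji
    by_cases hgj : g j = 0
    · rw [hgj, zero_smul]
    · have hle := hmin j (Finset.mem_filter.mpr ⟨hj, hgj⟩)
      rw [coeff_rowSum_mul_colAlt_mul_pe fun ρ τ _ hr hτ hc h' =>
        eq_one_of_mul_eq e hinj j.2.1 i.2.1 j.2.2 i.2.2 hle hr hτ hc h',
        if_neg fun h' => hji (Subtype.ext h'), smul_zero]
  · exact fun h' => absurd his h'

/-- An element which satisfies the relations of the Young symmetrizer is a multiple of it. -/
theorem SpechtRel.exists_eq_mul [CharZero K] {row col : A → ℕ} (hinj : PosInjective row col)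
    {X : Finset A} (hX : IsDiagram row col X) {w : MonoidAlgebra K (Equiv.Perm A)}
    (hw : SpechtRel col X w) : ∃ x, w = x * (rowSum K row X * colAlt K col X) := by
  classical
  set c := rowSum K row X * colAlt K col X with hc
  let e := Fintype.equivFin A
  have hli := linearIndependent_standard (K := K) e hinj X
  -- By independence there is a linear `φ` with `c * σ ↦ w * σ` for standard `σ`. Straightening
  -- applies to `c` and `w` alike, since `relIdeal` kills both, so the formula holds for every
  -- permutation of `X`.
  obtain ⟨φ, hφ⟩ := LinearMap.exists_extend
    ((Module.Basis.span hli).constr K fun σ => w * pe K σ.1)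
  have hφ' : ∀ σ, σ ∈ permsOf X → IsStandard row col (fun a => e a) X σ →
      φ (c * pe K σ) = w * pe K σ := fun σ h1 h2 => by
    have h3 := congrArg (fun f => f (Module.Basis.span hli ⟨σ, h1, h2⟩)) hφ
    rwa [LinearMap.comp_apply, Module.Basis.constr_basis, Submodule.subtype_apply,
      Module.Basis.span_apply] at h3
  have hall : ∀ σ ∈ permsOf X, φ (c * pe K σ) = w * pe K σ := by
    intro σ hσ
    have hle : relIdeal K col X ⊔ Submodule.span K (pe K '' {σ' | σ' ∈ permsOf X ∧
        IsStandard row col (fun a => e a) X σ' ∧ ∀ a, (e a : ℕ) = 0 → col (σ' a) ≤ col (σ a)}) ≤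
        LinearMap.eqLocus (φ ∘ₗ LinearMap.mulLeft K c) (LinearMap.mulLeft K w) := by
      refine sup_le (fun y hy => ?_) (Submodule.span_le.mpr ?_)
      · change φ (c * y) = w * y
        rw [hy w hw, hy c (spechtRel_rowSum_mul_colAlt hX), map_zero]
      · rintro _ ⟨σ', ⟨h1, h2, -⟩, rfl⟩
        exact hφ' σ' h1 h2
    exact hle (pe_mem_relIdeal_sup_standard (fun a => (e a : ℕ)) hinj hX hσ)
  set H : Finset (Equiv.Perm A) := Finset.univ.filter (· ∈ permsOf X) with hH
  have hcard : (H.card : K) ≠ 0 := Nat.cast_ne_zero.mpr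
    (Finset.card_ne_zero_of_mem (Finset.mem_filter.mpr ⟨Finset.mem_univ _, one_mem _⟩))
  -- Averaging as in Maschke's theorem turns `φ`, which need not commute with right multiplication,
  -- into left multiplication by `x`: one gets `x * c = ∑ φ (c * h) * h⁻¹ = |H| w`.
  let x : MonoidAlgebra K (Equiv.Perm A) := ∑ h ∈ H, φ (pe K h) * pe K h⁻¹
  have hx : ∀ g ∈ permsOf X, x * pe K g = ∑ h ∈ H, φ (pe K g * pe K h) * pe K h⁻¹ := by
    intro g hg
    rw [Finset.sum_mul]
    refine Finset.sum_nbij' (g⁻¹ * ·) (g * ·) ?_ ?_ ?_ ?_ ?_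
    · intro h hh
      exact Finset.mem_filter.mpr ⟨Finset.mem_univ _,
        mul_mem (inv_mem hg) (Finset.mem_filter.mp hh).2⟩
    · intro h hh
      exact Finset.mem_filter.mpr ⟨Finset.mem_univ _, mul_mem hg (Finset.mem_filter.mp hh).2⟩
    · intro h _; exact mul_inv_cancel_left g h
    · intro h _; exact inv_mul_cancel_left g h
    · intro h _
      rw [← pe_mul, mul_inv_cancel_left, mul_inv_rev, inv_inv, mul_assoc, ← pe_mul]
  have hxc : x * c = ∑ h ∈ H, φ (c * pe K h) * pe K h⁻¹ := by
    rw [hc, rowSum_mul_colAlt]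
    simp only [Finset.mul_sum, Finset.sum_mul, map_sum, mul_smul_comm, smul_mul_assoc, map_smul]
    rw [Finset.sum_comm (s := H)]
    refine Finset.sum_congr rfl fun ρ hρ => ?_
    rw [Finset.sum_comm (s := H)]
    refine Finset.sum_congr rfl fun τ hτ => ?_
    rw [← Finset.smul_sum, hx _ (mul_mem (Finset.mem_filter.mp hρ).2.1
      (Finset.mem_filter.mp hτ).2.1)]
  have hxw : x * c = (H.card : K) • w := by
    rw [hxc, Nat.cast_smul_eq_nsmul, ← Finset.sum_const]
    refine Finset.sum_congr rfl fun h hh => ?_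
    rw [hall h (Finset.mem_filter.mp hh).2, mul_assoc, ← pe_mul, mul_inv_cancel, pe_one, mul_one]
  refine ⟨(H.card : K)⁻¹ • x, ?_⟩
  rw [smul_mul_assoc, hxw, smul_smul, inv_mul_cancel₀ hcard, one_smul]

end Specht

/-! ### The decomposition of the Young symmetrizer. -/

section Specht

variable {A : Type u} [Fintype A] [DecidableEq A] {K : Type v} [Field K]

/-- The Young symmetrizer of a tableau, modulo multiples of the Young symmetrizer of a
subdiagram `X`, is a combination of its translates by permutations which move the elements of `X`
to the left, and take `X` to a diagram. -/
theorem rowSum_mul_colAlt_eq_add [CharZero K] {row col : A → ℕ} (hinj : PosInjective row col)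
    (hA : IsDiagram row col Finset.univ) {X : Finset A} (hX : IsDiagram row col X) :
    ∃ x y, rowSum K row Finset.univ * colAlt K col Finset.univ =
        x * (rowSum K row X * colAlt K col X) + y ∧
      y ∈ orbitSpan (rowSum K row Finset.univ * colAlt K col Finset.univ)
        (fun σ => MovesLeft col X Finset.univ σ ∧
          IsStandard row col (fun a => if a ∈ X then 0 else 1) Finset.univ σ) := by
  set c := rowSum K row Finset.univ * colAlt K col (Finset.univ : Finset A) with hc
  have hcrel : SpechtRel col Finset.univ c := spechtRel_rowSum_mul_colAlt hA
  obtain ⟨η, w, hη, hw, hmem⟩ := hcrel.exists_restrict hinj hX (Finset.subset_univ X) hA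
  obtain ⟨x, hx⟩ := hw.exists_eq_mul hinj hX
  refine ⟨η⁻¹ • x, -(η⁻¹ • (w - η • c)), ?_, neg_mem (Submodule.smul_mem _ _ ?_)⟩
  · rw [smul_mul_assoc, ← hx, smul_sub, smul_smul, inv_mul_cancel₀ hη, one_smul]
    abel
  · refine Submodule.span_le.mpr ?_ hmem
    rintro _ ⟨σ, ⟨hσ, hle, hlt⟩, rfl⟩
    -- For this two-valued order, standardness says that the boxes receiving letters of `X` form a
    -- diagram, and the letters of order `0`, which may not move right, are exactly those of `X`.
    have hs := pe_mem_relIdeal_sup_standard (K := K) (fun a => if a ∈ X then 0 else 1) hinj hA hσ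
    refine (SetLike.le_def.mp (sup_le ?_ (Submodule.span_le.mpr ?_)) hs :
      pe K σ ∈ (orbitSpan c _).comap (LinearMap.mulLeft K c))
    · intro y hy
      rw [Submodule.mem_comap, LinearMap.mulLeft_apply, hy c hcrel]
      exact zero_mem _
    · rintro _ ⟨σ', ⟨h1, h2, h3⟩, rfl⟩
      have h3' : ∀ s ∈ X, col (σ' s) ≤ col (σ s) := fun s hs => h3 s (if_pos hs)
      refine mem_orbitSpan ⟨⟨h1, fun s hs => (h3' s hs).trans (hle s hs), ?_⟩, h2⟩
      obtain ⟨s, hs, h⟩ := hlt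
      exact ⟨s, hs, (h3' s hs).trans_lt h⟩

end Specht

/-! ### Comparison of column sequences -/

section Columns

theorem forall₂_orderedInsert {l l' : List ℕ} (h : List.Forall₂ (· ≤ ·) l l')
    (hl : l.Pairwise (· ≤ ·)) (hl' : l'.Pairwise (· ≤ ·)) {a b : ℕ} (hab : a ≤ b) :
    List.Forall₂ (· ≤ ·) (l.orderedInsert (· ≤ ·) a) (l'.orderedInsert (· ≤ ·) b) := by
  have hsort : ∀ {x : ℕ} {l : List ℕ}, (x :: l).Pairwise (· ≤ ·) →
      l.orderedInsert (· ≤ ·) x = x :: l := by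
    intro x l h
    cases l with
    | nil => rfl
    | cons y l => exact List.orderedInsert_cons_of_le _ _ (List.rel_of_pairwise_cons h (by simp))
  induction h generalizing a b with
  | nil => exact List.Forall₂.cons hab List.Forall₂.nil
  | @cons x y l l' hxy h ih =>
    have ih' := @ih hl.of_cons hl'.of_cons
    rw [List.orderedInsert, List.orderedInsert]
    split_ifs with h1 h2 h2
    · exact List.Forall₂.cons hab (List.Forall₂.cons hxy h)
    · refine List.Forall₂.cons (by omega) ?_
      rw [← hsort hl]
      exact ih' (by omega)
    · refine List.Forall₂.cons (by omega) ?_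
      rw [← hsort hl']
      exact ih' (by omega)
    · exact List.Forall₂.cons hxy (ih' hab)

theorem forall₂_sort_map {α : Type*} (s : Multiset α) {f g : α → ℕ} (h : ∀ a ∈ s, f a ≤ g a) :
    List.Forall₂ (· ≤ ·) ((s.map f).sort (· ≤ ·)) ((s.map g).sort (· ≤ ·)) := by
  induction s using Quotient.inductionOn with
  | h l =>
  simp only [Multiset.quot_mk_to_coe, Multiset.map_coe, Multiset.coe_sort,
    List.mergeSort_eq_insertionSort]
  simp only [Multiset.quot_mk_to_coe, Multiset.mem_coe] at h
  induction l with
  | nil => exact List.Forall₂.nil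
  | cons a l ih =>
    rw [List.map_cons, List.map_cons, List.insertionSort_cons, List.insertionSort_cons]
    exact forall₂_orderedInsert (ih fun b hb => h b (List.mem_cons_of_mem a hb))
      (List.pairwise_insertionSort _ _) (List.pairwise_insertionSort _ _) (h a (by simp))

/-- Strictness in `ColLT` thus becomes a strict inequality of column sums, which needs no sorting.
-/
theorem sum_lt_sum_iff_of_forall₂ {l l' : List ℕ} (h : List.Forall₂ (· ≤ ·) l l') :
    l.sum ≤ l'.sum ∧ (l.sum < l'.sum ↔ ∃ i, l.getD i 0 < l'.getD i 0) := by
  induction h with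
  | nil => simp
  | @cons a b l l' hab _ ih =>
    rw [List.sum_cons, List.sum_cons]
    refine ⟨by omega, fun hlt => ?_, fun ⟨i, hi⟩ => ?_⟩
    · by_cases hab' : a < b
      · exact ⟨0, hab'⟩
      · obtain ⟨i, hi⟩ := ih.2.mp (by omega)
        exact ⟨i + 1, hi⟩
    · cases i with
      | zero =>
        have hi' : a < b := hi
        omega
      | succ i =>
        have := ih.2.mpr ⟨i, hi⟩
        omega

theorem forall₂_le_trans {l₁ l₂ l₃ : List ℕ} (h : List.Forall₂ (· ≤ ·) l₁ l₂)
    (h' : List.Forall₂ (· ≤ ·) l₂ l₃) : List.Forall₂ (· ≤ ·) l₁ l₃ := by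
  induction h generalizing l₃ with
  | nil => exact h'
  | cons hab _ ih =>
    cases h' with
    | cons hbc h' => exact List.Forall₂.cons (hab.trans hbc) (ih h')

variable {lam : YoungDiagram}

theorem sum_colSeq (X : Finset (Box lam)) : (colSeq X).sum = ∑ c ∈ X, c.col := by
  rw [colSeq, ← Multiset.sum_coe, Multiset.sort_eq]
  rfl

theorem ColLE.sum_le {X X' : Finset (Box lam)} (h : ColLE X X') :
    ∑ c ∈ X, c.col ≤ ∑ c ∈ X', c.col := by
  rw [← sum_colSeq, ← sum_colSeq]
  exact (sum_lt_sum_iff_of_forall₂ h).1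

theorem colLT_iff {X X' : Finset (Box lam)} :
    ColLT X X' ↔ ColLE X X' ∧ ∑ c ∈ X, c.col < ∑ c ∈ X', c.col := by
  rw [← sum_colSeq, ← sum_colSeq]
  exact and_congr_right fun h => (sum_lt_sum_iff_of_forall₂ h).2.symm

theorem ColLE.trans {X Y Z : Finset (Box lam)} (h : ColLE X Y) (h' : ColLE Y Z) : ColLE X Z :=
  forall₂_le_trans h h'

theorem colLE_map {X : Finset (Box lam)} {π : Equiv.Perm (Box lam)}
    (h : ∀ c ∈ X, (π c).col ≤ c.col) : ColLE (X.map π.toEmbedding) X := by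
  have := forall₂_sort_map X.val (f := fun c => (π c).col) (g := Box.col) h
  rw [ColLE, colSeq, colSeq, Finset.map_val, Multiset.map_map]
  exact this

end Columns

/-! ### Left moves of tableaux. -/

section LeftMoves

variable {d n : ℕ} {lam : YoungDiagram}

/-- The total of the columns of the boxes with entries in `[k]`. -/
def DTableau.colSum (F : DTableau d n lam) (k : ℕ) : ℕ :=
  ∑ i ∈ Finset.univ.filter (fun i : Fin n => (i : ℕ) < k), ∑ c ∈ F.fiber i, c.col

theorem colSum_lt_of_mem_leftMoves {F G : DTableau d n lam} {k : ℕ} (h : G ∈ leftMoves F k) :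
    G.colSum k < F.colSum k := by
  obtain ⟨hle, ⟨i, hi, hlt⟩, -⟩ := h
  refine Finset.sum_lt_sum (fun j hj => (hle j (Finset.mem_filter.mp hj).2).sum_le)
    ⟨i, Finset.mem_filter.mpr ⟨Finset.mem_univ i, hi⟩, (colLT_iff.mp hlt).2⟩

theorem leftMoves_trans {F G G' : DTableau d n lam} {k : ℕ} (h : G ∈ leftMoves F k)
    (h' : G' ∈ leftMoves G k) : G' ∈ leftMoves F k := by
  obtain ⟨hle, -, -⟩ := h
  obtain ⟨hle', ⟨i, hi, hlt⟩, hdelta⟩ := h'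
  refine ⟨fun j hj => (hle' j hj).trans (hle j hj), ⟨i, hi, colLT_iff.mpr ?_⟩, hdelta⟩
  exact ⟨(hle' i hi).trans (hle i hi), (colLT_iff.mp hlt).2.trans_le (hle i hi).sum_le⟩

/-- The tableau obtained by moving the entry of the box `c` to the box `π c`. -/
def DTableau.permute (F : DTableau d n lam) (π : Equiv.Perm (Box lam)) : DTableau d n lam where
  entry c := F.entry (π.symm c)
  card_fiber i := by
    refine Eq.trans (Finset.card_equiv π.symm fun c => ?_) (F.card_fiber i)
    simp

theorem DTableau.fiber_permute (F : DTableau d n lam) (π : Equiv.Perm (Box lam)) (i : Fin n) :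
    (F.permute π).fiber i = (F.fiber i).map π.toEmbedding := by
  ext c
  rw [Finset.mem_map_equiv, fiber, fiber, Finset.mem_filter, Finset.mem_filter]
  exact and_congr (iff_of_true (Finset.mem_univ _) (Finset.mem_univ _)) Iff.rfl

theorem DTableau.blockPartition_permute {A : Type u} (F : DTableau d n lam)
    (π : Equiv.Perm (Box lam)) (T : Box lam ≃ A) (σ : Equiv.Perm A)
    (h : ∀ c, T (π c) = σ (T c)) :
    (F.permute π).blockPartition T = (F.blockPartition T).map σ := by
  have key : ∀ i, T '' ((F.permute π).fiber i : Set (Box lam)) =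
      σ '' (T '' (F.fiber i : Set (Box lam))) := fun i => by
    rw [fiber_permute, Finset.coe_map, Set.image_image, Set.image_image]
    exact Set.image_congr fun c _ => h c
  ext b
  simp only [blockPartition, BlockPartition.map, Set.mem_image, Set.mem_range,
    exists_exists_eq_and, key]

theorem permute_mem_leftMoves {F : DTableau d n lam} {k : ℕ} {mu : YoungDiagram}
    (hF : F.PreimageEq k mu) {π : Equiv.Perm (Box lam)}
    (hle : ∀ c : Box lam, c.1 ∈ mu.cells → (π c).col ≤ c.col)
    (hlt : ∃ c : Box lam, c.1 ∈ mu.cells ∧ (π c).col < c.col)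
    (hstd : ∀ c c' : Box lam, ((π c).col = (π c').col ∧ (π c).row < (π c').row) ∨
      ((π c).row = (π c').row ∧ (π c).col < (π c').col) → c'.1 ∈ mu.cells → c.1 ∈ mu.cells) :
    F.permute π ∈ leftMoves F k := by
  have hmem : ∀ i : Fin n, (i : ℕ) < k → ∀ c ∈ F.fiber i, c.1 ∈ mu.cells := fun i hi c hc => by
    rw [← hF, (Finset.mem_filter.mp hc).2]
    exact hi
  have hCle : ∀ i : Fin n, (i : ℕ) < k → ColLE ((F.permute π).fiber i) (F.fiber i) :=
    fun i hi => by
      rw [F.fiber_permute]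
      exact colLE_map fun c hc => hle c (hmem i hi c hc)
  refine ⟨hCle, ?_, ?_⟩
  · obtain ⟨c, hc, hclt⟩ := hlt
    refine ⟨F.entry c, (hF c).mpr hc, colLT_iff.mpr ⟨hCle _ ((hF c).mpr hc), ?_⟩⟩
    rw [F.fiber_permute, Finset.sum_map]
    exact Finset.sum_lt_sum (fun x hx => hle x (hmem _ ((hF c).mpr hc) x hx))
      ⟨c, Finset.mem_filter.mpr ⟨Finset.mem_univ c, rfl⟩, hclt⟩
  · have hstd' : ∀ c c' : Box lam, ((π c).col = (π c').col ∧ (π c).row ≤ (π c').row) ∨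
        ((π c).row = (π c').row ∧ (π c).col ≤ (π c').col) → c'.1 ∈ mu.cells → c.1 ∈ mu.cells := by
      intro c c' h hc'
      by_cases he : π c = π c'
      · rwa [π.injective he]
      · refine hstd c c' ?_ hc'
        have : ¬ ((π c).row = (π c').row ∧ (π c).col = (π c').col) := fun h' =>
          he (Subtype.ext (Prod.ext h'.1 h'.2))
        omega
    let delta : YoungDiagram :=
      { cells := (Finset.univ.filter fun c : Box lam => (π.symm c).1 ∈ mu.cells).map
          (Function.Embedding.subtype _)
        isLowerSet := by
          rintro x y hyx hx
          simp only [Finset.coe_map, Set.mem_image, Finset.mem_coe, Finset.mem_filter,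
            Finset.mem_univ, true_and, Function.Embedding.subtype_apply] at hx ⊢
          obtain ⟨c, hc, rfl⟩ := hx
          -- Standardness compares only boxes in a common row or column, so the passage from `c` to
          -- `y` goes through the corner in the row of `y` and the column of `c`.
          have h1 : (y.1, c.1.2) ∈ lam.cells := lam.isLowerSet (Prod.le_def.mpr ⟨hyx.1, le_rfl⟩) c.2
          have h2 : y ∈ lam.cells := lam.isLowerSet hyx c.2
          refine ⟨⟨y, h2⟩, ?_, rfl⟩
          have h3 : (π.symm ⟨_, h1⟩).1 ∈ mu.cells := hstd' _ (π.symm c) (Or.inl (by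
            simp only [Equiv.apply_symm_apply]
            exact ⟨rfl, hyx.1⟩)) hc
          exact hstd' _ (π.symm ⟨_, h1⟩) (Or.inr (by
            simp only [Equiv.apply_symm_apply]
            exact ⟨rfl, hyx.2⟩)) h3 }
    refine ⟨delta, fun x hx => ?_, fun c => ?_⟩
    · obtain ⟨c, -, rfl⟩ := Finset.mem_map.mp hx
      exact c.2
    · change (F.entry (π.symm c) : ℕ) < k ↔ _
      rw [hF]
      simp [delta]

end LeftMoves

/-! ### The action of the group algebra on `Sym^(d)` -/

section Action

variable {K : Type v} [Field K] {d : ℕ}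

/-- The action of the group algebra on `Sym^(d)_A`. -/
noncomputable abbrev act {A : Type u} (y : MonoidAlgebra K (Equiv.Perm A)) :
    SymD K d A →ₗ[K] SymD K d A :=
  (symRep K d A).asAlgebraHom y

theorem act_mul {A : Type u} (x y : MonoidAlgebra K (Equiv.Perm A)) (z : SymD K d A) :
    act (x * y) z = act x (act y z) := by
  rw [act, map_mul]
  rfl

theorem act_single {A : Type u} (σ : Equiv.Perm A) (r : K) (z : SymD K d A) :
    act (MonoidAlgebra.single σ r) z = r • mapLin K σ z := by
  rw [act, Representation.asAlgebraHom_single]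
  rfl

theorem act_pe {A : Type u} [Fintype A] [DecidableEq A] (σ : Equiv.Perm A) (z : SymD K d A) :
    act (pe K σ) z = mapLin K σ z := by
  rw [pe_eq_single, act_single, one_smul]

theorem mapLin_monomial {A B : Type u} (e : A ≃ B) (P : BlockPartition d A) :
    mapLin K e (monomial K P) = monomial K (P.map e) := by
  simp [mapLin, monomial]

theorem mapLin_mapLin {A B C : Type u} (e : A ≃ B) (f : B ≃ C) (z : SymD K d A) :
    mapLin K f (mapLin K e z) = mapLin K (e.trans f) z := by
  rw [mapLin_trans]
  rfl

theorem GIdeal.act_mem (I : GIdeal.{u} K d) {A : DSet.{u} d} {z : SymD K d A.carrier}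
    (hz : z ∈ I.obj A) (y : MonoidAlgebra K (Equiv.Perm A.carrier)) : act y z ∈ I.obj A := by
  induction y using MonoidAlgebra.induction_on with
  | of σ =>
    rw [MonoidAlgebra.of_apply, act_single]
    exact Submodule.smul_mem _ _ (I.map_mem σ hz)
  | add x y hx hy =>
    rw [act, map_add]
    exact add_mem hx hy
  | smul r y hy =>
    rw [act, map_smul]
    exact Submodule.smul_mem _ _ hy

theorem BlockPartition.map_sum {A A' B B' : Type u} (e : A ≃ A') (f : B ≃ B')
    (P : BlockPartition d A) (Q : BlockPartition d B) :
    (P.sum Q).map (e.sumCongr f) = (P.map e).sum (Q.map f) := by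
  ext b
  simp only [BlockPartition.map, BlockPartition.sum, Set.image_union, Set.image_image,
    Equiv.sumCongr_apply, Sum.map_inl, Sum.map_inr]

theorem mapLin_mul {A A' B B' : Type u} (e : A ≃ A') (f : B ≃ B') (x : SymD K d A)
    (y : SymD K d B) :
    mapLin K (e.sumCongr f) (mul K x y) = mul K (mapLin K e x) (mapLin K f y) := by
  induction x using Finsupp.induction_linear with
  | zero => simp only [map_zero, LinearMap.zero_apply]
  | add x x' hx hx' => simp only [map_add, LinearMap.add_apply, hx, hx']
  | single P r =>
    induction y using Finsupp.induction_linear with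
    | zero => simp only [map_zero]
    | add y y' hy hy' => simp only [map_add, hy, hy']
    | single Q s =>
      have h1 : (Finsupp.single P r : SymD K d A) = r • monomial K P := by simp [monomial]
      have h2 : (Finsupp.single Q s : SymD K d B) = s • monomial K Q := by simp [monomial]
      rw [h1, h2]
      simp only [map_smul, LinearMap.smul_apply, mul_monomial, mapLin_monomial,
        BlockPartition.map_sum]

end Action

/-! ### Young symmetrizers of subdiagrams -/

section Subdiagram

variable {A : Type u} [Fintype A] [DecidableEq A] (K : Type v) [Field K] {d : ℕ}
  {lam : YoungDiagram}

theorem youngSymmetrizer_eq (T : Box lam ≃ A) :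
    youngSymmetrizer K T = rowSum K (fun a => (T.symm a).row) Finset.univ *
      colAlt K (fun a => (T.symm a).col) Finset.univ := by
  classical
  rw [youngSymmetrizer, rowSymmetrizer, colAntisymmetrizer, rowSum, colAlt]
  congr 1
  · refine Finset.sum_congr (Finset.filter_congr fun σ _ => ?_) fun σ _ => rfl
    exact ⟨fun h => ⟨fun a ha => absurd (Finset.mem_univ a) ha, h⟩, fun h => h.2⟩
  · refine Finset.sum_congr (Finset.filter_congr fun σ _ => ?_) fun σ _ => ?_
    · exact ⟨fun h => ⟨fun a ha => absurd (Finset.mem_univ a) ha, h⟩, fun h => h.2⟩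
    · rw [pe_eq_single, MonoidAlgebra.smul_single, smul_eq_mul, mul_one, sgn]

theorem posInjective_symm (T : Box lam ≃ A) :
    PosInjective (fun a => (T.symm a).row) (fun a => (T.symm a).col) := fun _ _ h1 h2 =>
  T.symm.injective (Subtype.ext (Prod.ext h1 h2))

theorem isDiagram_symm (T : Box lam ≃ A) {mu : YoungDiagram} (h : mu ≤ lam) :
    IsDiagram (fun a => (T.symm a).row) (fun a => (T.symm a).col)
      (Finset.univ.filter fun a => (T.symm a).1 ∈ mu.cells) := by
  intro x hx i hi j hj
  have h1 : (i, j) ∈ mu.cells :=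
    mu.isLowerSet (Prod.le_def.mpr ⟨hi, hj⟩) (Finset.mem_filter.mp hx).2
  refine ⟨T ⟨(i, j), h h1⟩, Finset.mem_filter.mpr ⟨Finset.mem_univ _, ?_⟩, ?_, ?_⟩ <;>
    simp only [Equiv.symm_apply_apply]
  · exact h1
  · rfl
  · rfl

variable {K} {p : A → Prop} [DecidablePred p] [Fintype {a // p a}] [DecidableEq {a // p a}]

theorem mapLin_ofSubtype (σ : Equiv.Perm {a // p a}) (x : SymD K d {a // p a})
    (y : SymD K d {a // ¬ p a}) :
    mapLin K (Equiv.Perm.ofSubtype σ) (mapLin K (Equiv.sumCompl p) (mul K x y)) =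
      mapLin K (Equiv.sumCompl p) (mul K (mapLin K σ x) y) := by
  have e : (Equiv.sumCompl p).trans (Equiv.Perm.ofSubtype σ) =
      (σ.sumCongr (Equiv.refl {a // ¬ p a})).trans (Equiv.sumCompl p) := by
    ext a
    rcases a with a | a
    · simp
    · simpa using Equiv.Perm.ofSubtype_apply_of_not_mem σ a.2
  rw [mapLin_mapLin, e, ← mapLin_mapLin, mapLin_mul, mapLin_refl, LinearMap.id_apply]

theorem bijective_ofSubtype (X : Finset A) (hX : ∀ a, a ∈ X ↔ p a) (f : A → ℕ) :
    (∀ σ : Equiv.Perm {a // p a}, (∀ a, f (σ a) = f a) →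
      Equiv.Perm.ofSubtype σ ∈ permsOf X ∧ ∀ a, f (Equiv.Perm.ofSubtype σ a) = f a) ∧
    ∀ σ : Equiv.Perm A, σ ∈ permsOf X → (∀ a, f (σ a) = f a) →
      ∃ σ₀ : Equiv.Perm {a // p a}, (∀ a, f (σ₀ a) = f a) ∧ Equiv.Perm.ofSubtype σ₀ = σ := by
  refine ⟨fun σ h => ⟨fun a ha => Equiv.Perm.ofSubtype_apply_of_not_mem σ (mt (hX a).mpr ha),
    fun a => ?_⟩, fun σ hσ h => ⟨σ.subtypePerm fun a => ?_, fun a => h a, ?_⟩⟩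
  · by_cases ha : p a
    · rw [Equiv.Perm.ofSubtype_apply_of_mem σ ha]
      exact h ⟨a, ha⟩
    · rw [Equiv.Perm.ofSubtype_apply_of_not_mem σ ha]
  · rw [← hX, ← hX]
    exact apply_mem_iff_of_mem_permsOf hσ
  · refine Equiv.Perm.ofSubtype_subtypePerm _ fun a ha => ?_
    by_contra h'
    exact ha (hσ a (mt (hX a).mp h'))

variable {mu : YoungDiagram} (S : Box mu ≃ {a // p a})
theorem act_rowSum (X : Finset A) (hX : ∀ a, a ∈ X ↔ p a) {row : A → ℕ}
    (hrow : ∀ a, (S.symm a).row = row a) (x : SymD K d {a // p a})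
    (y : SymD K d {a // ¬ p a}) :
    act (rowSum K row X) (mapLin K (Equiv.sumCompl p) (mul K x y)) =
      mapLin K (Equiv.sumCompl p) (mul K (act (rowSymmetrizer K S) x) y) := by
  classical
  rw [act, act, rowSum, rowSymmetrizer, map_sum, map_sum, LinearMap.sum_apply,
    LinearMap.sum_apply, map_sum, LinearMap.sum_apply, map_sum]
  have hb := bijective_ofSubtype X hX row
  symm
  refine Finset.sum_bij (fun σ _ => Equiv.Perm.ofSubtype σ) ?_ ?_ ?_ ?_
  · intro σ hσ
    have hσ' : ∀ a, (S.symm (σ a)).row = (S.symm a).row := (Finset.mem_filter.mp hσ).2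
    exact Finset.mem_filter.mpr ⟨Finset.mem_univ _, hb.1 σ fun a => by
      rw [← hrow, hσ', hrow]⟩
  · intro σ _ σ' _ h
    exact Equiv.Perm.ofSubtype_injective h
  · intro σ hσ
    obtain ⟨h1, h2⟩ := (Finset.mem_filter.mp hσ).2
    obtain ⟨σ₀, h3, h4⟩ := hb.2 σ h1 h2
    refine ⟨σ₀, Finset.mem_filter.mpr ⟨Finset.mem_univ _, fun a => ?_⟩, h4⟩
    rw [hrow, hrow, h3]
  · intro σ _
    rw [act_pe, mapLin_ofSubtype, act_single, one_smul]

theorem act_colAlt (X : Finset A) (hX : ∀ a, a ∈ X ↔ p a) {col : A → ℕ}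
    (hcol : ∀ a, (S.symm a).col = col a) (x : SymD K d {a // p a})
    (y : SymD K d {a // ¬ p a}) :
    act (colAlt K col X) (mapLin K (Equiv.sumCompl p) (mul K x y)) =
      mapLin K (Equiv.sumCompl p) (mul K (act (colAntisymmetrizer K S) x) y) := by
  classical
  rw [act, act, colAlt, colAntisymmetrizer, map_sum, map_sum, LinearMap.sum_apply,
    LinearMap.sum_apply, map_sum, LinearMap.sum_apply, map_sum]
  have hb := bijective_ofSubtype X hX col
  symm
  refine Finset.sum_bij (fun σ _ => Equiv.Perm.ofSubtype σ) ?_ ?_ ?_ ?_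
  · intro σ hσ
    have hσ' : ∀ a, (S.symm (σ a)).col = (S.symm a).col := (Finset.mem_filter.mp hσ).2
    exact Finset.mem_filter.mpr ⟨Finset.mem_univ _, hb.1 σ fun a => by
      rw [← hcol, hσ', hcol]⟩
  · intro σ _ σ' _ h
    exact Equiv.Perm.ofSubtype_injective h
  · intro σ hσ
    obtain ⟨h1, h2⟩ := (Finset.mem_filter.mp hσ).2
    obtain ⟨σ₀, h3, h4⟩ := hb.2 σ h1 h2
    refine ⟨σ₀, Finset.mem_filter.mpr ⟨Finset.mem_univ _, fun a => ?_⟩, h4⟩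
    rw [hcol, hcol, h3]
  · intro σ _
    have hs : sgn K (Equiv.Perm.ofSubtype σ) = ((Equiv.Perm.sign σ : ℤˣ) : ℤ) := by
      have h : Equiv.Perm.sign (Equiv.Perm.ofSubtype σ) = Equiv.Perm.sign σ := by
        convert Equiv.Perm.sign_ofSubtype σ
      rw [sgn, h]
    rw [map_smul, LinearMap.smul_apply, act_pe, mapLin_ofSubtype, act_single, hs, map_smul,
      LinearMap.smul_apply, map_smul]

/-- The symmetrizer of a subdiagram only permutes the letters of the subdiagram, so it acts on the
first factor of a product alone. -/
theorem act_rowSum_mul_colAlt (X : Finset A) (hX : ∀ a, a ∈ X ↔ p a) {row col : A → ℕ}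
    (hrow : ∀ a, (S.symm a).row = row a)
    (hcol : ∀ a, (S.symm a).col = col a) (x : SymD K d {a // p a})
    (y : SymD K d {a // ¬ p a}) :
    act (rowSum K row X * colAlt K col X) (mapLin K (Equiv.sumCompl p) (mul K x y)) =
      mapLin K (Equiv.sumCompl p) (mul K (act (youngSymmetrizer K S) x) y) := by
  rw [act_mul, act_colAlt S X hX hcol, act_rowSum S X hX hrow, youngSymmetrizer, act_mul]

end Subdiagram

/-! ### Restriction of tableaux and membership in ideals. -/

section Restriction

variable {d n k : ℕ} {lam mu : YoungDiagram}

theorem DTableau.card_box (F : DTableau d n lam) : Nat.card (Box lam) = n * d := by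
  rw [Nat.card_eq_fintype_card, ← Finset.card_univ,
    Finset.card_eq_sum_card_fiberwise (f := F.entry) (t := Finset.univ)
      (fun c _ => Finset.mem_coe.mpr (Finset.mem_univ _)),
    Finset.sum_congr rfl fun i _ => F.card_fiber i]
  simp

/-- The restriction of a Young tableau to a subdiagram. -/
def restrictEquiv {A : Type u} (T : Box lam ≃ A) (h : mu ≤ lam) :
    Box mu ≃ {a // (T.symm a).1 ∈ mu.cells} where
  toFun c := ⟨T (Box.incl h c), by rw [Equiv.symm_apply_apply]; exact c.2⟩
  invFun a := ⟨(T.symm a.1).1, a.2⟩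
  left_inv c := Subtype.ext (by simp [Box.incl])
  right_inv a := Subtype.ext (by simp [Box.incl])

/-- The partition of the complement of a subdiagram, by the entries which are not in `[k]`. -/
def DTableau.complPartition {A : Type u} (F : DTableau d n lam) (hF : F.PreimageEq k mu)
    (T : Box lam ≃ A) : BlockPartition d {a // ¬ (T.symm a).1 ∈ mu.cells} where
  blocks := {b | ∃ i : Fin n, k ≤ i ∧ b = {a | F.entry (T.symm a.1) = i}}
  ncard_eq := by
    rintro _ ⟨i, hi, rfl⟩
    have h : Subtype.val '' {a : {a // ¬ (T.symm a).1 ∈ mu.cells} | F.entry (T.symm a.1) = i} =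
        T '' (F.fiber i : Set (Box lam)) := by
      ext a
      simp only [Set.mem_image, Set.mem_ofPred_eq, Finset.mem_coe, fiber, Finset.mem_filter,
        Finset.mem_univ, true_and]
      constructor
      · rintro ⟨a, ha, rfl⟩
        exact ⟨_, ha, T.apply_symm_apply _⟩
      · rintro ⟨c, hc, rfl⟩
        refine ⟨⟨T c, ?_⟩, by simpa using hc, rfl⟩
        rw [Equiv.symm_apply_apply, ← hF, hc, not_lt]
        exact hi
    rw [← Set.ncard_image_of_injective _ Subtype.val_injective, h,
      Set.ncard_image_of_injective _ T.injective, Set.ncard_coe_finset]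
    exact F.card_fiber i
  existsUnique_mem := by
    intro a
    refine ⟨_, ⟨⟨F.entry (T.symm a.1), ?_, rfl⟩, rfl⟩, ?_⟩
    · rw [← not_lt, hF]
      exact a.2
    · rintro _ ⟨⟨i, -, rfl⟩, h⟩
      have h' : F.entry (T.symm a.1) = i := h
      rw [h']

theorem DTableau.blockPartition_eq_map_sum {A : Type u} (F : DTableau d n lam) (hkn : k ≤ n)
    (hF : F.PreimageEq k mu) (h : mu ≤ lam) (T : Box lam ≃ A)
    [DecidablePred fun a => (T.symm a).1 ∈ mu.cells] :
    F.blockPartition T =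
      (((F.restrict hkn h hF).blockPartition (restrictEquiv T h)).sum
        (F.complPartition hF T)).map (Equiv.sumCompl fun a => (T.symm a).1 ∈ mu.cells) := by
  have h1 : ∀ i : Fin k, (Equiv.sumCompl fun a => (T.symm a).1 ∈ mu.cells) ''
      (Sum.inl '' (restrictEquiv T h '' ((F.restrict hkn h hF).fiber i : Set (Box mu)))) =
      T '' (F.fiber (Fin.castLE hkn i) : Set (Box lam)) := by
    intro i
    ext a
    simp only [Set.mem_image, Finset.mem_coe, fiber, Finset.mem_filter, Finset.mem_univ, true_and,
      exists_exists_and_eq_and]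
    constructor
    · rintro ⟨c, hc, rfl⟩
      have hc' := Fin.ext_iff.mp hc
      exact ⟨Box.incl h c, Fin.ext hc', rfl⟩
    · rintro ⟨c, hc, rfl⟩
      have hcmu : c.1 ∈ mu.cells := by
        rw [← hF, hc]
        exact i.2
      have hc' := Fin.ext_iff.mp hc
      exact ⟨⟨c.1, hcmu⟩, Fin.ext hc', rfl⟩
  have h2 : ∀ i : Fin n, k ≤ i → (Equiv.sumCompl fun a => (T.symm a).1 ∈ mu.cells) ''
      (Sum.inr '' {a : {a // ¬ (T.symm a).1 ∈ mu.cells} | F.entry (T.symm a.1) = i}) =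
      T '' (F.fiber i : Set (Box lam)) := by
    intro i hi
    ext a
    simp only [Set.mem_image, Finset.mem_coe, fiber, Finset.mem_filter, Finset.mem_univ, true_and,
      Set.mem_ofPred_eq, exists_exists_and_eq_and]
    constructor
    · rintro ⟨a, ha, rfl⟩
      exact ⟨_, ha, T.apply_symm_apply _⟩
    · rintro ⟨c, hc, rfl⟩
      refine ⟨⟨T c, ?_⟩, by simpa using hc, rfl⟩
      rw [Equiv.symm_apply_apply, ← hF, hc, not_lt]
      exact hi
  ext b
  constructor
  · rintro ⟨i, rfl⟩
    by_cases hi : (i : ℕ) < k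
    · exact ⟨_, Or.inl ⟨_, ⟨⟨i, hi⟩, rfl⟩, rfl⟩, h1 ⟨i, hi⟩⟩
    · exact ⟨_, Or.inr ⟨_, ⟨i, not_lt.mp hi, rfl⟩, rfl⟩, h2 i (not_lt.mp hi)⟩
  · rintro ⟨_, ⟨_, ⟨i, rfl⟩, rfl⟩ | ⟨_, ⟨i, hi, rfl⟩, rfl⟩, rfl⟩
    · exact ⟨Fin.castLE hkn i, (h1 i).symm⟩
    · exact ⟨i, (h2 i hi).symm⟩

variable {K : Type v} [Field K]

theorem GIdeal.elements_add_subset {I I' J : GIdeal.{u} K d} (h : ∀ A, I.obj A ≤ J.obj A)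
    (h' : ∀ A, I'.obj A ≤ J.obj A) : (I + I').elements ⊆ J.elements :=
  fun x hx => sup_le (h x.1) (h' x.1) hx

/-- Applying the Young symmetrizer of a subdiagram to the monomial of `F` gives an element of the
ideal generated by the restriction of `F`. -/
theorem act_restrict_mem_span (F : DTableau d n lam) (hkn : k ≤ n) (hF : F.PreimageEq k mu)
    (h : mu ≤ lam) (A : DSet.{u} d) (T : Box lam ≃ A.carrier) :
    act (rowSum K (fun a => (T.symm a).row)
        (Finset.univ.filter fun a => (T.symm a).1 ∈ mu.cells) *
      colAlt K (fun a => (T.symm a).col)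
        (Finset.univ.filter fun a => (T.symm a).1 ∈ mu.cells))
      (monomial K (F.blockPartition T)) ∈
    (GIdeal.span ((F.restrict hkn h hF).tabloid K)).obj A := by
  have hd₀ : d ∣ Nat.card {a // (T.symm a).1 ∈ mu.cells} := by
    rw [← Nat.card_congr (restrictEquiv T h), (F.restrict hkn h hF).card_box]
    exact Nat.dvd_mul_left d k
  have hd₁ : d ∣ Nat.card {a // ¬ (T.symm a).1 ∈ mu.cells} := by
    have hc := A.dvd_card
    rw [← Nat.card_congr (Equiv.sumCompl fun a => (T.symm a).1 ∈ mu.cells), Nat.card_sum] at hc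
    exact (Nat.dvd_add_right hd₀).mp hc
  let A₀ : DSet.{u} d := ⟨{a // (T.symm a).1 ∈ mu.cells}, inferInstance, hd₀⟩
  let A₁ : DSet.{u} d := ⟨{a // ¬ (T.symm a).1 ∈ mu.cells}, inferInstance, hd₁⟩
  have hmem : (F.restrict hkn h hF).tabloidElt K A₀ (restrictEquiv T h) ∈
      (GIdeal.span.{u, v} ((F.restrict hkn h hF).tabloid K)).obj A₀ :=
    GIdeal.subset_span ((F.restrict hkn h hF).tabloid K)
      (show (⟨A₀, (F.restrict hkn h hF).tabloidElt K A₀ (restrictEquiv T h)⟩ : Elt K d) ∈ _ from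
        ⟨A₀, restrictEquiv T h, rfl⟩)
  have hmul := GIdeal.map_mem _ (B := A) (Equiv.sumCompl fun a => (T.symm a).1 ∈ mu.cells)
    (GIdeal.mul_mem _ (B := A₁) (monomial K (F.complPartition hF T)) hmem)
  have hact := act_rowSum_mul_colAlt (K := K) (p := fun a => (T.symm a).1 ∈ mu.cells)
    (restrictEquiv T h) (Finset.univ.filter fun a => (T.symm a).1 ∈ mu.cells)
    (fun a => by simp) (row := fun a => (T.symm a).row) (col := fun a => (T.symm a).col)
    (fun _ => rfl) (fun _ => rfl)
    (monomial K ((F.restrict hkn h hF).blockPartition (restrictEquiv T h)))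
    (monomial K (F.complPartition hF T))
  rw [F.blockPartition_eq_map_sum hkn hF h T, ← mapLin_monomial, ← mul_monomial, hact]
  rw [DTableau.tabloidElt] at hmul
  convert hmul

theorem tabloid_subset_add [CharZero K] (F : DTableau d n lam) (hkn : k ≤ n)
    (hF : F.PreimageEq k mu) (h : mu ≤ lam) :
    F.tabloid K ⊆ (GIdeal.span.{u, v} ((F.restrict hkn h hF).tabloid K) +
      GIdeal.span.{u, v} (⋃ G ∈ leftMoves F k, G.tabloid K)).elements := by
  rintro _ ⟨A, T, rfl⟩
  change F.tabloidElt K A T ∈ (GIdeal.span _).obj A ⊔ (GIdeal.span _).obj A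
  set X : Finset A.carrier := Finset.univ.filter fun a => (T.symm a).1 ∈ mu.cells with hX
  have hmemX : ∀ a, a ∈ X ↔ (T.symm a).1 ∈ mu.cells := fun a => by simp [hX]
  have hlam : IsDiagram (fun a => (T.symm a).row) (fun a => (T.symm a).col)
      (Finset.univ : Finset A.carrier) := by
    have := isDiagram_symm T (le_refl lam)
    rwa [Finset.filter_true_of_mem fun a _ => (T.symm a).2] at this
  obtain ⟨x, y, hxy, hy⟩ := rowSum_mul_colAlt_eq_add (K := K) (posInjective_symm T) hlam
    (isDiagram_symm T h)
  rw [DTableau.tabloidElt, youngSymmetrizer_eq, hxy, map_add, LinearMap.add_apply]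
  refine Submodule.add_mem_sup ?_ ?_
  · have h1 := GIdeal.act_mem _ (act_restrict_mem_span (K := K) F hkn hF h A T) x
    rwa [← act_mul] at h1
  -- `N` consists of the group algebra elements which send the monomial of `F` into the ideal of the
  -- left moves; it suffices to check the generators `c * σ`.
  · let N : Submodule K (MonoidAlgebra K (Equiv.Perm A.carrier)) :=
      ((GIdeal.span.{u, v} (⋃ G ∈ leftMoves F k, G.tabloid K)).obj A).comap
        ((LinearMap.applyₗ (monomial K (F.blockPartition T))).comp
          (symRep K d A.carrier).asAlgebraHom.toLinearMap)
    refine (Submodule.span_le (p := N)).mpr ?_ hy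
    rintro _ ⟨σ, ⟨⟨-, hle, hlt⟩, hstd⟩, rfl⟩
    rw [SetLike.mem_coe, Submodule.mem_comap]
    change act (rowSum K (fun a => (T.symm a).row) Finset.univ *
      colAlt K (fun a => (T.symm a).col) Finset.univ * pe K σ) (monomial K (F.blockPartition T)) ∈ _
    rw [act_mul, act_pe, mapLin_monomial, ← youngSymmetrizer_eq]
    -- `σ` transported to the boxes: applying `σ` to the monomial of `F` amounts to moving the
    -- entries of `F` by `π`.
    set π : Equiv.Perm (Box lam) := (T.trans σ).trans T.symm with hπ
    have hπc : ∀ c, T (π c) = σ (T c) := fun c => T.apply_symm_apply _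
    have hG : F.permute π ∈ leftMoves F k := by
      refine permute_mem_leftMoves hF (fun c hc => ?_) ?_ (fun c c' hcc hc' => ?_)
      · simpa [hπ] using hle (T c) ((hmemX _).mpr (by simpa using hc))
      · obtain ⟨s, hs, hlt⟩ := hlt
        exact ⟨T.symm s, (hmemX s).mp hs, by simpa [hπ] using hlt⟩
      · have := hstd (T c) (T c') (Finset.mem_univ _) (Finset.mem_univ _) hcc
        simp only [← hX, hmemX, Equiv.symm_apply_apply, if_pos hc'] at this
        by_contra hc
        rw [if_neg hc] at this
        omega
    rw [← F.blockPartition_permute π T σ hπc]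
    exact GIdeal.subset_span (⋃ G ∈ leftMoves F k, G.tabloid K) (Set.mem_biUnion hG
      (show (⟨A, (F.permute π).tabloidElt K A T⟩ : Elt K d) ∈ _ from ⟨A, T, rfl⟩))

/-- Apply `tabloid_subset_add` to `G` itself: left moves of `G` are again left moves of `F`, with
smaller `colSum`, so the induction terminates and only restrictions remain. -/
theorem tabloid_subset_restrict [CharZero K] (F : DTableau d n lam) (hkn : k ≤ n) :
    ∀ G ∈ leftMoves F k, G.tabloid K ⊆ (GIdeal.span.{u, v}
      {x | ∃ G ∈ leftMoves F k, ∃ (delta : YoungDiagram) (hdelta : delta ≤ lam)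
        (hG : G.PreimageEq k delta), x ∈ (G.restrict hkn hdelta hG).tabloid K}).elements := by
  intro G hG
  induction hm : G.colSum k using Nat.strong_induction_on generalizing G with
  | _ m ih =>
  obtain ⟨-, -, delta, hdelta, hGd⟩ := id hG
  refine (tabloid_subset_add G hkn hGd hdelta).trans (GIdeal.elements_add_subset
    (GIdeal.span_le fun y hy => ?_) (GIdeal.span_le (Set.iUnion₂_subset fun G' hG' => ?_)))
  · exact GIdeal.subset_span _ ⟨G, hG, delta, hdelta, hGd, hy⟩
  · exact ih _ (hm ▸ colSum_lt_of_mem_leftMoves hG') G' (leftMoves_trans hG hG') rfl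

end Restriction

end GenericSym

theorem mainTheorem5 {K : Type v} [Field K] [CharZero K] (k n d : ℕ) (hk : 0 < k) (hkn : k ≤ n)
    (hd : 0 < d) (lam mu : YoungDiagram) (hlam : lam.card = n * d) (hmu : mu.card = k * d)
    (hsub : mu ≤ lam) (F : GenericSym.DTableau d n lam) (hF : F.PreimageEq k mu) :
    F.tabloid K ⊆
        (GenericSym.GIdeal.span.{u, v} ((F.restrict hkn hsub hF).tabloid K) +
          GenericSym.GIdeal.span.{u, v} (⋃ G ∈ GenericSym.leftMoves F k, G.tabloid K)).elements ∧
      F.tabloid K ⊆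
        (GenericSym.GIdeal.span.{u, v} ((F.restrict hkn hsub hF).tabloid K) +
          GenericSym.GIdeal.span.{u, v}
            {x | ∃ G ∈ GenericSym.leftMoves F k, ∃ (delta : YoungDiagram) (hdelta : delta ≤ lam)
              (hG : G.PreimageEq k delta),
              x ∈ (G.restrict hkn hdelta hG).tabloid K}).elements := by
  have h := GenericSym.tabloid_subset_add (K := K) F hkn hF hsub
  refine ⟨h, h.trans (GenericSym.GIdeal.elements_add_subset (fun _ => le_sup_left) fun A =>
    (GenericSym.GIdeal.span_le (Set.iUnion₂_subset fun G hG => ?_) A).trans le_sup_right)⟩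
  exact GenericSym.tabloid_subset_restrict F hkn G hG
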